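/- There is a single deterministic algorithm $A$ with the following property. Its input is a finite graph $G$ together with an integer $q\ge 0$ (the number of colours that may be used). Fix a real $\epsilon\in(0,1/2)$ and a function $q:\mathbb N\to\mathbb N$ such that $q(n)\ge 3$ for all $n\ge 1$ and $q(n)=\Theta(n^{\epsilon})$ as $n\to\infty$. Then, for every $3$-colourable graph $G$ with $n$ vertices, $A$ on input $(G,q(n))$ halts and outputs a proper colouring of $G$ with at most $q(n)$ colours. Moreover, its worst-case running time $T(n)$ on the inputs $(G,q(n))$, with $G$ ranging over all $3$-colourable graphs with $n$ vertices, satisfies $T(n)=2^{\Theta(n^{1-2\epsilon}\log n)}$ as $n\to\infty$, where the implicit constants may depend on $\epsilon$ and on the function $q(\cdot)$. (Running time is the number of steps on a deterministic random access machine with unit-cost addition and subtraction of natural numbers, $G$ being given by its adjacency matrix.) -/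

import Mathlib

open Filter Asymptotics

namespace RAM

/-- The configuration of a random access machine: registers with fixed names, and a memory that is
addressed indirectly. Every cell holds a natural number. -/
structure State where
  reg : ℕ → ℕ
  mem : ℕ → ℕ

/-- Programs of a random access machine, in structured form. `reg r` is written `r` below.
There is no multiplication, shift or bitwise instruction, so that the unit-cost step count is
polynomially related to the running time on a multitape Turing machine. -/
inductive Cmd where
  /-- `r := c` -/
  | const (r c : ℕ) : Cmd
  /-- `r := a` -/
  | move (r a : ℕ) : Cmd
  /-- `r := a + b` -/
  | add (r a b : ℕ) : Cmd
  /-- `r := max (a - b) 0` -/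
  | sub (r a b : ℕ) : Cmd
  /-- `r := mem[a]` -/
  | load (r a : ℕ) : Cmd
  /-- `mem[a] := b` -/
  | store (a b : ℕ) : Cmd
  /-- first `c`, then `d` -/
  | seq (c d : Cmd) : Cmd
  /-- if `a ≠ 0` then `c` else `d` -/
  | ite (a : ℕ) (c d : Cmd) : Cmd
  /-- while `a ≠ 0` do `c` -/
  | loop (a : ℕ) (c : Cmd) : Cmd

def State.setReg (s : State) (r x : ℕ) : State :=
  { s with reg := Function.update s.reg r x }

def State.setMem (s : State) (a x : ℕ) : State :=
  { s with mem := Function.update s.mem a x }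

/-- `Runs c s t s'`: started in the configuration `s`, the program `c` halts after exactly `t`
steps in the configuration `s'`. Every instruction and every test of a register is one step. -/
inductive Runs : Cmd → State → ℕ → State → Prop
  | const (s : State) (r c : ℕ) : Runs (.const r c) s 1 (s.setReg r c)
  | move (s : State) (r a : ℕ) : Runs (.move r a) s 1 (s.setReg r (s.reg a))
  | add (s : State) (r a b : ℕ) : Runs (.add r a b) s 1 (s.setReg r (s.reg a + s.reg b))
  | sub (s : State) (r a b : ℕ) : Runs (.sub r a b) s 1 (s.setReg r (s.reg a - s.reg b))
  | load (s : State) (r a : ℕ) : Runs (.load r a) s 1 (s.setReg r (s.mem (s.reg a)))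
  | store (s : State) (a b : ℕ) : Runs (.store a b) s 1 (s.setMem (s.reg a) (s.reg b))
  | seq {c d : Cmd} {s₀ s₁ s₂ : State} {t₁ t₂ : ℕ} :
      Runs c s₀ t₁ s₁ → Runs d s₁ t₂ s₂ → Runs (.seq c d) s₀ (t₁ + t₂) s₂
  | ite_true {c d : Cmd} {a : ℕ} {s s' : State} {t : ℕ} :
      s.reg a ≠ 0 → Runs c s t s' → Runs (.ite a c d) s (t + 1) s'
  | ite_false {c d : Cmd} {a : ℕ} {s s' : State} {t : ℕ} :
      s.reg a = 0 → Runs d s t s' → Runs (.ite a c d) s (t + 1) s'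
  | loop_done {c : Cmd} {a : ℕ} {s : State} :
      s.reg a = 0 → Runs (.loop a c) s 1 s
  | loop_step {c : Cmd} {a : ℕ} {s₀ s₁ s₂ : State} {t₁ t₂ : ℕ} :
      s₀.reg a ≠ 0 → Runs c s₀ t₁ s₁ → Runs (.loop a c) s₁ t₂ s₂ →
        Runs (.loop a c) s₀ (t₁ + t₂ + 1) s₂

/-- The machine is deterministic: the number of steps and the final configuration are determined
by the program and the initial configuration. -/
theorem Runs.deterministic {c : Cmd} {s s₁ s₂ : State} {t₁ t₂ : ℕ}
    (h₁ : Runs c s t₁ s₁) (h₂ : Runs c s t₂ s₂) : t₁ = t₂ ∧ s₁ = s₂ := by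
  induction h₁ generalizing t₂ s₂ with
  | const | move | add | sub | load | store => cases h₂; exact ⟨rfl, rfl⟩
  | seq _ _ ih₁ ih₂ =>
    cases h₂ with
    | seq k₁ k₂ =>
      obtain ⟨rfl, rfl⟩ := ih₁ k₁
      obtain ⟨rfl, rfl⟩ := ih₂ k₂
      exact ⟨rfl, rfl⟩
  | ite_true ha _ ih =>
    cases h₂ with
    | ite_true _ k => obtain ⟨rfl, rfl⟩ := ih k; exact ⟨rfl, rfl⟩
    | ite_false hb _ => exact absurd hb ha
  | ite_false ha _ ih =>
    cases h₂ with
    | ite_true hb _ => exact absurd ha hb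
    | ite_false _ k => obtain ⟨rfl, rfl⟩ := ih k; exact ⟨rfl, rfl⟩
  | loop_done ha =>
    cases h₂ with
    | loop_done _ => exact ⟨rfl, rfl⟩
    | loop_step hb _ _ => exact absurd ha hb
  | loop_step ha _ _ ih₁ ih₂ =>
    cases h₂ with
    | loop_done hb => exact absurd hb ha
    | loop_step _ k₁ k₂ =>
      obtain ⟨rfl, rfl⟩ := ih₁ k₁
      obtain ⟨rfl, rfl⟩ := ih₂ k₂
      exact ⟨rfl, rfl⟩

open Classical in
/-- The initial configuration for the input `(G, q)`, where `G` is a graph with vertices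
`0, …, n - 1`: register `0` holds `n`, register `1` holds `q`, the memory cells `n * u + v` hold
the adjacency matrix of `G`, and everything else is `0`. -/
noncomputable def input {n : ℕ} (G : SimpleGraph (Fin n)) (q : ℕ) : State where
  reg r := if r = 0 then n else if r = 1 then q else 0
  mem a := if ∃ u v : Fin n, a = n * u + v ∧ G.Adj u v then 1 else 0

/-- On the input `(G, q)` the program `P` halts, and the memory cells `n * n + v`, for the vertices
`v = 0, …, n - 1`, then hold a proper colouring of `G` with colours `0, …, q - 1`. -/
def FindsColoring (P : Cmd) {n : ℕ} (G : SimpleGraph (Fin n)) (q : ℕ) : Prop :=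
  ∃ (t : ℕ) (s : State), Runs P (input G q) t s ∧
    ∃ C : G.Coloring (Fin q), ∀ v : Fin n, s.mem (n * n + v) = C v

/-- `T` is the worst-case running time of `P` over all inputs `(G, q)` where `G` is a
`3`-colourable graph with `n` vertices. -/
def IsWorstCaseTime (P : Cmd) (n q T : ℕ) : Prop :=
  IsGreatest {t : ℕ | ∃ G : SimpleGraph (Fin n), G.Colorable 3 ∧
    ∃ s : State, Runs P (input G q) t s} T

end RAM

/-! Let m = q / 12. If m = 0, all q^n colourings are tried. Otherwise there are m rounds with six
fresh colours each, followed by a greedy phase with 6m further colours, in total 12m ≤ q.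

A round guesses up to L = n / m² + 1 vertices together with their colours in a proper 3-colouring f.
An uncoloured neighbour of a vertex of colour c does not have colour c. So if the guess is right, f
takes at most two values on each of the three resulting classes; each class induces a bipartite
graph and gets two fresh colours. A good guess picks vertices greedily, each with at least 6m
uncoloured neighbours that are not yet covered (`exists_digits`). Either this works L times, and the
round colours at least 6mL vertices, or every vertex has fewer than 6m uncoloured neighbours left.
As m · 6mL ≥ n, after m rounds either everything is coloured or the rest can be finished greedily
(`exists_good_code`, `Prog.eval_round`, `Prog.eval_main`).

Each round enumerates all (3n + 1)^L guesses and does not stop at a success. Hence on every input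
the time is at least this number, and it is at most polynomial in it. The logarithm of this number
has order L log n, that is n^(1 - 2ε) log n, because m has order n^ε (`exists_time_bounds`,
`theta_of_bounds`).

To obtain a machine program, the algorithm is written in a language whose loops are all bounded. A
program then has a total denotation `Prog.eval` and an exact step count `Prog.cost`, and
`Prog.runs_compile` shows that the compiled code realises both. Correctness becomes a statement
about functions on stores, and the upper time bound follows from the syntax by `Prog.cost_le` and
`Prog.polyBounded_bound`. -/

/-! ### A small structured language with bounded loops and lexically scoped variables -/

namespace LoopLang

open RAM Finset

/-- The data that a program manipulates: the cells `0, …, b` of the memory and sixteen arrays. -/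
structure Store where
  b : ℕ
  low : ℕ → ℕ
  arr : Fin 16 → ℕ → ℕ

def Store.setLow (σ : Store) (a x : ℕ) : Store :=
  { σ with low := Function.update σ.low a x }

def Store.setArr (σ : Store) (k : Fin 16) (a x : ℕ) : Store :=
  { σ with arr := Function.update σ.arr k (Function.update (σ.arr k) a x) }

/-- Expressions do not change the store. There is no product: a `sum` whose summand does not depend
on the bound variable multiplies, and division is done by counting. -/
inductive Expr where
  | cst (c : ℕ) : Expr
  | var (i : ℕ) : Expr
  | add (e f : Expr) : Expr
  | sub (e f : Expr) : Expr
  | low (e : Expr) : Expr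
  | get (k : Fin 16) (e : Expr) : Expr
  | ite (e f g : Expr) : Expr
  /-- the sum of `e` over the values of `i` below the value of `p` -/
  | sum (p i : ℕ) (e : Expr) : Expr

/-- Loop bounds are values of variables, and variables change only through `loop` and `bind`, within
their scope. Hence every program terminates, and `eval` and `cost` are defined by structural
recursion. -/
inductive Prog where
  | skip : Prog
  | out (e f : Expr) : Prog
  | store (k : Fin 16) (e f : Expr) : Prog
  | seq (c d : Prog) : Prog
  | ite (e : Expr) (c d : Prog) : Prog
  /-- run `c` for each value of `i` below the value of `p` -/
  | loop (p i : ℕ) (c : Prog) : Prog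
  /-- run `c` with `i` bound to the value of `e` -/
  | bind (i : ℕ) (e : Expr) (c : Prog) : Prog

/-- Addresses in `low` are cut off at `b`, so that no such access reaches the cells in which the
arrays are stored. -/
def Expr.eval (σ : Store) : Expr → (ℕ → ℕ) → ℕ
  | .cst c, _ => c
  | .var i, ρ => ρ i
  | .add e f, ρ => e.eval σ ρ + f.eval σ ρ
  | .sub e f, ρ => e.eval σ ρ - f.eval σ ρ
  | .low e, ρ => σ.low (min (e.eval σ ρ) σ.b)
  | .get k e, ρ => σ.arr k (e.eval σ ρ)
  | .ite e f g, ρ => if e.eval σ ρ ≠ 0 then f.eval σ ρ else g.eval σ ρ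
  | .sum p i e, ρ => ∑ j ∈ range (ρ p), e.eval σ (Function.update ρ i j)

/-- `iter f j σ` applies `f 0`, …, `f (j - 1)` to `σ` in this order. -/
def iter (f : ℕ → Store → Store) : ℕ → Store → Store
  | 0, σ => σ
  | j + 1, σ => f j (iter f j σ)

def Prog.eval : Prog → (ℕ → ℕ) → Store → Store
  | .skip, _, σ => σ
  | .out e f, ρ, σ => σ.setLow (min (e.eval σ ρ) σ.b) (f.eval σ ρ)
  | .store k e f, ρ, σ => σ.setArr k (e.eval σ ρ) (f.eval σ ρ)
  | .seq c d, ρ, σ => d.eval ρ (c.eval ρ σ)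
  | .ite e c d, ρ, σ => if e.eval σ ρ ≠ 0 then c.eval ρ σ else d.eval ρ σ
  | .loop p i c, ρ, σ => iter (fun j => c.eval (Function.update ρ i j)) (ρ p) σ
  | .bind i e c, ρ, σ => c.eval (Function.update ρ i (e.eval σ ρ)) σ

/-! ### Compilation to the random access machine

The variable `i` lives in the register `2 * i`, the number `b` in register `1`, and the registers
`tmp d` with `1 ≤ d` are used as a stack. -/

def tmp (d : ℕ) : ℕ := 2 * d + 1

/-- Replaces the index in `tmp d` by the address of this cell of the array `k`. -/
def address (k : Fin 16) (d e : ℕ) : Cmd :=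
  .seq (.add (tmp d) (tmp d) (tmp d)) <| .seq (.add (tmp d) (tmp d) (tmp d)) <|
  .seq (.add (tmp d) (tmp d) (tmp d)) <| .seq (.add (tmp d) (tmp d) (tmp d)) <|
  .seq (.add (tmp d) (tmp d) 1) <| .seq (.const (tmp e) (1 + k)) (.add (tmp d) (tmp d) (tmp e))

/-- The value is left in `tmp d`; lower stack entries are untouched and the registers of bound
variables are restored. Since `tmp 0` is the register of `b`, the stack starts at 1. -/
def Expr.compile : Expr → ℕ → Cmd
  | .cst c, d => .const (tmp d) c
  | .var i, d => .move (tmp d) (2 * i)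
  | .add e f, d => .seq (e.compile d) <| .seq (f.compile (d + 1)) <|
      .add (tmp d) (tmp d) (tmp (d + 1))
  | .sub e f, d => .seq (e.compile d) <| .seq (f.compile (d + 1)) <|
      .sub (tmp d) (tmp d) (tmp (d + 1))
  -- Truncated subtraction yields the minimum: a - (a - b) = min a b.
  | .low e, d => .seq (e.compile d) <| .seq (.sub (tmp (d + 1)) (tmp d) 1) <|
      .seq (.sub (tmp d) (tmp d) (tmp (d + 1))) <| .load (tmp d) (tmp d)
  | .get k e, d => .seq (e.compile d) <| .seq (address k d (d + 1)) <| .load (tmp d) (tmp d)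
  | .ite e f g, d => .seq (e.compile d) <| .ite (tmp d) (f.compile d) (g.compile d)
  | .sum p i e, d =>
      .seq (.const (tmp d) 0) <| .seq (.move (tmp (d + 1)) (2 * i)) <|
      .seq (.move (tmp (d + 2)) (2 * p)) <| .seq (.const (2 * i) 0) <|
      .seq (.loop (tmp (d + 2)) <| .seq (e.compile (d + 3)) <|
        .seq (.add (tmp d) (tmp d) (tmp (d + 3))) <| .seq (.const (tmp (d + 3)) 1) <|
        .seq (.add (2 * i) (2 * i) (tmp (d + 3))) <|
        .sub (tmp (d + 2)) (tmp (d + 2)) (tmp (d + 3))) <|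
      .move (2 * i) (tmp (d + 1))

def Prog.compile : Prog → ℕ → Cmd
  | .skip, d => .const (tmp d) 0
  | .out e f, d => .seq (e.compile d) <| .seq (f.compile (d + 1)) <|
      .seq (.sub (tmp (d + 2)) (tmp d) 1) <| .seq (.sub (tmp d) (tmp d) (tmp (d + 2))) <|
      .store (tmp d) (tmp (d + 1))
  | .store k e f, d => .seq (e.compile d) <| .seq (f.compile (d + 1)) <|
      .seq (address k d (d + 2)) <| .store (tmp d) (tmp (d + 1))
  | .seq c₁ c₂, d => .seq (c₁.compile d) (c₂.compile d)
  | .ite e c₁ c₂, d => .seq (e.compile d) <| .ite (tmp d) (c₁.compile d) (c₂.compile d)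
  | .loop p i c, d =>
      .seq (.move (tmp d) (2 * i)) <| .seq (.move (tmp (d + 1)) (2 * p)) <|
      .seq (.const (2 * i) 0) <|
      .seq (.loop (tmp (d + 1)) <| .seq (c.compile (d + 2)) <| .seq (.const (tmp (d + 2)) 1) <|
        .seq (.add (2 * i) (2 * i) (tmp (d + 2))) <|
        .sub (tmp (d + 1)) (tmp (d + 1)) (tmp (d + 2))) <|
      .move (2 * i) (tmp d)
  | .bind i e c, d => .seq (e.compile (d + 1)) <| .seq (.move (tmp d) (2 * i)) <|
      .seq (.move (2 * i) (tmp (d + 1))) <| .seq (c.compile (d + 1)) <| .move (2 * i) (tmp d)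

/-- The number of steps of the compiled expression. -/
def Expr.cost (σ : Store) : Expr → (ℕ → ℕ) → ℕ
  | .cst _, _ => 1
  | .var _, _ => 1
  | .add e f, ρ => e.cost σ ρ + f.cost σ ρ + 1
  | .sub e f, ρ => e.cost σ ρ + f.cost σ ρ + 1
  | .low e, ρ => e.cost σ ρ + 3
  | .get _ e, ρ => e.cost σ ρ + 8
  | .ite e f g, ρ => e.cost σ ρ + 1 + if e.eval σ ρ ≠ 0 then f.cost σ ρ else g.cost σ ρ
  | .sum p i e, ρ => (∑ j ∈ range (ρ p), (e.cost σ (Function.update ρ i j) + 5)) + 6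

/-- The number of steps of the compiled program. -/
def Prog.cost : Prog → (ℕ → ℕ) → Store → ℕ
  | .skip, _, _ => 1
  | .out e f, ρ, σ => e.cost σ ρ + f.cost σ ρ + 3
  | .store _ e f, ρ, σ => e.cost σ ρ + f.cost σ ρ + 8
  | .seq c d, ρ, σ => c.cost ρ σ + d.cost ρ (c.eval ρ σ)
  | .ite e c d, ρ, σ => e.cost σ ρ + 1 + if e.eval σ ρ ≠ 0 then c.cost ρ σ else d.cost ρ σ
  | .loop p i c, ρ, σ => (∑ j ∈ range (ρ p), (c.cost (Function.update ρ i j)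
      (iter (fun j => c.eval (Function.update ρ i j)) j σ) + 4)) + 5
  | .bind i e c, ρ, σ => e.cost σ ρ + 3 + c.cost (Function.update ρ i (e.eval σ ρ)) σ

/-- The machine configuration `s` represents the variables `ρ` and the store `σ`. -/
structure Represents (s : State) (ρ : ℕ → ℕ) (σ : Store) : Prop where
  var : ∀ i, s.reg (2 * i) = ρ i
  b : s.reg 1 = σ.b
  low : ∀ a ≤ σ.b, s.mem a = σ.low a
  arr : ∀ (k : Fin 16) a, s.mem (σ.b + 1 + 16 * a + k) = σ.arr k a

/-! ### Correctness and exact running time of compiled code. -/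

theorem Represents.congr {s s' : State} {ρ : ℕ → ℕ} {σ : Store} {d : ℕ} (h : Represents s ρ σ)
    (hd : 1 ≤ d) (hm : s'.mem = s.mem)
    (hr : ∀ r, r % 2 = 0 ∨ r < tmp d → s'.reg r = s.reg r) : Represents s' ρ σ where
  var i := by rw [hr _ (.inl (by omega)), h.var]
  b := by rw [hr _ (.inr (by unfold tmp; omega)), h.b]
  low := by rw [hm]; exact h.low
  arr := by rw [hm]; exact h.arr

theorem runs_of_eq {c : Cmd} {s s' : State} {t t' : ℕ} (h : Runs c s t s') (e : t = t') :
    Runs c s t' s' := e ▸ h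

/-- Four doublings multiply the index by 16, the number of arrays, whose cells are interleaved. -/
theorem runs_address (k : Fin 16) (d e : ℕ) (hd : 1 ≤ d) (hde : d < e) (s : State) :
    ∃ s', Runs (address k d e) s 7 s' ∧ s'.mem = s.mem ∧
      s'.reg (tmp d) = s.reg 1 + 1 + 16 * s.reg (tmp d) + k ∧
      ∀ r, r ≠ tmp d → r ≠ tmp e → s'.reg r = s.reg r := by
  have h1 : tmp d ≠ tmp e := by unfold tmp; omega
  have h2 : (1 : ℕ) ≠ tmp d := by unfold tmp; omega
  refine ⟨_, .seq (.add _ _ _ _) (.seq (.add _ _ _ _) (.seq (.add _ _ _ _) (.seq (.add _ _ _ _)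
    (.seq (.add _ _ _ _) (.seq (.const _ _ _) (.add _ _ _ _)))))), ?_, ?_, ?_⟩
  · simp [State.setReg]
  · simp [State.setReg, h1, h2]
    omega
  · intro r hr hr'
    simp [State.setReg, hr, hr']

theorem Represents.setVar {s : State} {ρ : ℕ → ℕ} {σ : Store} (h : Represents s ρ σ) (i x : ℕ) :
    Represents (s.setReg (2 * i) x) (Function.update ρ i x) σ where
  var j := by
    by_cases hj : j = i
    · subst hj; simp [State.setReg]
    · simp [State.setReg, hj, h.var]
  b := by
    have : (1 : ℕ) ≠ 2 * i := by omega
    simp [State.setReg, this, h.b]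
  low := h.low
  arr := h.arr

theorem Represents.setTmp {s : State} {ρ : ℕ → ℕ} {σ : Store} (h : Represents s ρ σ) {d : ℕ}
    (hd : 1 ≤ d) (x : ℕ) : Represents (s.setReg (tmp d) x) ρ σ := by
  refine h.congr (d := d) hd rfl fun r hr => ?_
  have : r ≠ tmp d := by unfold tmp at *; omega
  simp [State.setReg, this]

/-- Symbolic evaluation of a register file after some assignments. -/
theorem reg_setReg (s : State) (r x r' : ℕ) :
    (s.setReg r x).reg r' = if r' = r then x else s.reg r' := by
  simp [State.setReg, Function.update_apply]

theorem mem_setReg (s : State) (r x : ℕ) : (s.setReg r x).mem = s.mem := rfl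

/-- The hypothesis `he` is the claim of `Expr.runs_compile` for the summand, so this is a case of
the induction there. The induction is on the number `k` of remaining iterations, with the number `j`
of completed ones arbitrary. -/
theorem Expr.runs_sum_loop {e : Expr} (he : ∀ d, 1 ≤ d → ∀ ρ σ s, Represents s ρ σ →
      ∃ s', Runs (e.compile d) s (e.cost σ ρ) s' ∧ s'.reg (tmp d) = e.eval σ ρ ∧
        s'.mem = s.mem ∧ ∀ r, r % 2 = 0 ∨ r < tmp d → s'.reg r = s.reg r)
    {d : ℕ} (hd : 1 ≤ d) (i : ℕ) (ρ : ℕ → ℕ) (σ : Store) (k : ℕ) : ∀ (j : ℕ) (s : State),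
    Represents s (Function.update ρ i j) σ → s.reg (tmp (d + 2)) = k →
    ∃ s', Runs (.loop (tmp (d + 2)) <| .seq (e.compile (d + 3)) <|
        .seq (.add (tmp d) (tmp d) (tmp (d + 3))) <| .seq (.const (tmp (d + 3)) 1) <|
        .seq (.add (2 * i) (2 * i) (tmp (d + 3))) <|
        .sub (tmp (d + 2)) (tmp (d + 2)) (tmp (d + 3))) s
        ((∑ l ∈ range k, (e.cost σ (Function.update ρ i (j + l)) + 5)) + 1) s' ∧
      s'.reg (tmp d) = s.reg (tmp d) + ∑ l ∈ range k, e.eval σ (Function.update ρ i (j + l)) ∧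
      s'.mem = s.mem ∧
      ∀ r, r ≠ 2 * i → r % 2 = 0 ∨ r < tmp d ∨ r = tmp (d + 1) → s'.reg r = s.reg r := by
  induction k with
  | zero => intro j s _ hk; exact ⟨s, runs_of_eq (.loop_done hk) (by simp), by simp, rfl, by simp⟩
  | succ k ih =>
    intro j s hs hk
    obtain ⟨s₁, r₁, v₁, m₁, f₁⟩ := he (d + 3) (by omega) _ _ _ hs
    have hs₁ := hs.congr (by omega) m₁ f₁
    have hvar : s₁.reg (2 * i) = j := by simpa using hs₁.var i
    have hrem : s₁.reg (tmp (d + 2)) = k + 1 := by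
      rw [f₁ _ (.inr (by unfold tmp; omega)), hk]
    have hacc : s₁.reg (tmp d) = s.reg (tmp d) := f₁ _ (.inr (by unfold tmp; omega))
    have body := Runs.seq r₁ (.seq (.add s₁ (tmp d) (tmp d) (tmp (d + 3))) (.seq
      (.const _ (tmp (d + 3)) 1) (.seq (.add _ (2 * i) (2 * i) (tmp (d + 3)))
        (.sub _ (tmp (d + 2)) (tmp (d + 2)) (tmp (d + 3))))))
    have e1 : tmp (d + 3) ≠ tmp d := by unfold tmp; omega
    have e2 : tmp (d + 2) ≠ tmp d := by unfold tmp; omega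
    have e3 : tmp (d + 2) ≠ tmp (d + 3) := by unfold tmp; omega
    have e4 : ∀ x, 2 * i ≠ tmp x := by unfold tmp; omega
    have e5 : tmp (d + 1) ≠ tmp d := by unfold tmp; omega
    have e6 : tmp (d + 1) ≠ tmp (d + 2) := by unfold tmp; omega
    have e7 : tmp (d + 1) ≠ tmp (d + 3) := by unfold tmp; omega
    -- Naming the state after the body allows the assigned values to be made explicit in `hs₂`; the
    -- state is then four assignments away from `s₁`.
    generalize hs₂ : State.setReg _ _ _ = s₂ at body
    simp only [reg_setReg, e1, e2, e3, e4, (e4 _).symm, hvar, hrem, hacc, v₁, if_true, if_false,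
      Nat.add_sub_cancel] at hs₂
    have hs₂' : Represents s₂ (Function.update ρ i (j + 1)) σ := by
      rw [← hs₂]
      have := (((hs₁.setTmp hd (s.reg (tmp d) + e.eval σ (Function.update ρ i j))).setTmp
        (d := d + 3) (by omega) 1).setVar i (j + 1)).setTmp (d := d + 2) (by omega) k
      simpa using this
    obtain ⟨s₃, r₃, v₃, m₃, f₃⟩ := ih (j + 1) s₂ hs₂' (by rw [← hs₂]; simp [reg_setReg])
    refine ⟨s₃, runs_of_eq (.loop_step (by omega) body r₃) ?_, ?_, ?_, ?_⟩
    · rw [sum_range_succ']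
      simp only [Nat.add_zero, add_comm, add_left_comm, add_assoc]
      omega
    · rw [v₃, sum_range_succ', ← hs₂]
      simp [reg_setReg, e2.symm, e1.symm, (e4 _).symm, add_comm, add_left_comm, add_assoc]
    · rw [m₃, ← hs₂, ← m₁]; rfl
    · intro r g4 hr
      rw [f₃ r g4 hr, ← hs₂]
      have g1 : r ≠ tmp d := by unfold tmp at *; omega
      have g2 : r ≠ tmp (d + 2) := by unfold tmp at *; omega
      have g3 : r ≠ tmp (d + 3) := by unfold tmp at *; omega
      simp only [reg_setReg, g1, g2, g3, g4, if_false]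
      exact f₁ r (by unfold tmp at *; omega)

/-- The frame condition on even registers and lower stack entries lets nested evaluations keep their
intermediate values on the stack. -/
theorem Expr.runs_compile (e : Expr) : ∀ d, 1 ≤ d → ∀ ρ σ s, Represents s ρ σ →
    ∃ s', Runs (e.compile d) s (e.cost σ ρ) s' ∧ s'.reg (tmp d) = e.eval σ ρ ∧
      s'.mem = s.mem ∧ ∀ r, r % 2 = 0 ∨ r < tmp d → s'.reg r = s.reg r := by
  have frame {d r : ℕ} (hr : r % 2 = 0 ∨ r < tmp d) : r ≠ tmp d ∧ r ≠ tmp (d + 1) ∧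
      (r % 2 = 0 ∨ r < tmp (d + 1)) := by unfold tmp at *; omega
  have lt_succ (d : ℕ) : tmp d < tmp (d + 1) := by unfold tmp; omega
  induction e with
  | cst c =>
    intro d hd ρ σ s hs
    exact ⟨_, .const _ _ _, by simp [reg_setReg, Expr.eval], rfl,
      fun r hr => by simp [reg_setReg, (frame hr).1]⟩
  | var i =>
    intro d hd ρ σ s hs
    exact ⟨_, .move _ _ _, by simp [reg_setReg, Expr.eval, hs.var], rfl,
      fun r hr => by simp [reg_setReg, (frame hr).1]⟩
  | add e f ihe ihf =>
    intro d hd ρ σ s hs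
    obtain ⟨s₁, r₁, v₁, m₁, f₁⟩ := ihe d hd ρ σ s hs
    obtain ⟨s₂, r₂, v₂, m₂, f₂⟩ := ihf (d + 1) (by omega) ρ σ s₁ (hs.congr hd m₁ f₁)
    refine ⟨_, runs_of_eq (.seq r₁ (.seq r₂ (.add _ _ _ _))) (by rw [Expr.cost]; omega), ?_,
      m₂.trans m₁, fun r hr => ?_⟩
    · simp [reg_setReg, Expr.eval, v₂, f₂ _ (.inr (lt_succ d)), v₁]
    · simp [reg_setReg, (frame hr).1, f₂ _ (frame hr).2.2, f₁ _ hr]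
  | sub e f ihe ihf =>
    intro d hd ρ σ s hs
    obtain ⟨s₁, r₁, v₁, m₁, f₁⟩ := ihe d hd ρ σ s hs
    obtain ⟨s₂, r₂, v₂, m₂, f₂⟩ := ihf (d + 1) (by omega) ρ σ s₁ (hs.congr hd m₁ f₁)
    refine ⟨_, runs_of_eq (.seq r₁ (.seq r₂ (.sub _ _ _ _))) (by rw [Expr.cost]; omega), ?_,
      m₂.trans m₁, fun r hr => ?_⟩
    · simp [reg_setReg, Expr.eval, v₂, f₂ _ (.inr (lt_succ d)), v₁]
    · simp [reg_setReg, (frame hr).1, f₂ _ (frame hr).2.2, f₁ _ hr]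
  | low e ihe =>
    intro d hd ρ σ s hs
    obtain ⟨s₁, r₁, v₁, m₁, f₁⟩ := ihe d hd ρ σ s hs
    have hs₁ := hs.congr hd m₁ f₁
    refine ⟨_, runs_of_eq (.seq r₁ (.seq (.sub _ _ _ _) (.seq (.sub _ _ _ _) (.load _ _ _))))
      (by rw [Expr.cost]), ?_, m₁, fun r hr => ?_⟩
    · have h : e.eval σ ρ - (e.eval σ ρ - σ.b) = min (e.eval σ ρ) σ.b := by omega
      simp [reg_setReg, mem_setReg, Expr.eval, v₁, (lt_succ d).ne, hs₁.b, h,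
        hs₁.low _ (min_le_right _ _)]
    · simp [reg_setReg, (frame hr).1, (frame hr).2.1, f₁ _ hr]
  | get k e ihe =>
    intro d hd ρ σ s hs
    obtain ⟨s₁, r₁, v₁, m₁, f₁⟩ := ihe d hd ρ σ s hs
    have hs₁ := hs.congr hd m₁ f₁
    obtain ⟨s₂, r₂, m₂, v₂, f₂⟩ := runs_address k d (d + 1) hd (by omega) s₁
    refine ⟨_, runs_of_eq (.seq r₁ (.seq r₂ (.load _ _ _))) (by rw [Expr.cost]), ?_,
      m₂.trans m₁, fun r hr => ?_⟩
    · simp [reg_setReg, Expr.eval, v₂, m₂, v₁, hs₁.b, hs₁.arr]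
    · simp [reg_setReg, (frame hr).1, f₂ _ (frame hr).1 (frame hr).2.1, f₁ _ hr]
  | ite e f g ihe ihf ihg =>
    intro d hd ρ σ s hs
    obtain ⟨s₁, r₁, v₁, m₁, f₁⟩ := ihe d hd ρ σ s hs
    have hs₁ := hs.congr hd m₁ f₁
    by_cases h : e.eval σ ρ = 0
    · obtain ⟨s₂, r₂, v₂, m₂, f₂⟩ := ihg d hd ρ σ s₁ hs₁
      refine ⟨s₂, runs_of_eq (.seq r₁ (.ite_false (v₁.trans h) r₂)) ?_, ?_, m₂.trans m₁,
        fun r hr => (f₂ r hr).trans (f₁ r hr)⟩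
      · simp [Expr.cost, h]; omega
      · simp [Expr.eval, h, v₂]
    · obtain ⟨s₂, r₂, v₂, m₂, f₂⟩ := ihf d hd ρ σ s₁ hs₁
      refine ⟨s₂, runs_of_eq (.seq r₁ (.ite_true (by rwa [v₁]) r₂)) ?_, ?_, m₂.trans m₁,
        fun r hr => (f₂ r hr).trans (f₁ r hr)⟩
      · simp [Expr.cost, h]; omega
      · simp [Expr.eval, h, v₂]
  | sum p i e ihe =>
    intro d hd ρ σ s hs
    have e4 : ∀ x, 2 * i ≠ tmp x := by unfold tmp; omega
    have e5 : ∀ x, 2 * p ≠ tmp x := by unfold tmp; omega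
    have e6 : tmp d ≠ tmp (d + 1) := by unfold tmp; omega
    have e7 : tmp d ≠ tmp (d + 2) := by unfold tmp; omega
    have e8 : tmp (d + 1) ≠ tmp (d + 2) := by unfold tmp; omega
    -- The instructions before the loop, with the remaining code, its time and its final state left
    -- open.
    have init := fun (c : Cmd) (t : ℕ) (s' : State) h =>
      Runs.seq (.const s (tmp d) 0) (.seq (.move _ (tmp (d + 1)) (2 * i))
      (.seq (.move _ (tmp (d + 2)) (2 * p)) (.seq (d := c) (t₂ := t) (s₂ := s')
        (.const _ (2 * i) 0) h)))
    generalize hs₁ : State.setReg (State.setReg _ (tmp (d + 2)) _) _ _ = s₁ at init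
    simp only [reg_setReg, e4, e5, hs.var, if_false] at hs₁
    have hs₁' : Represents s₁ (Function.update ρ i 0) σ := by
      rw [← hs₁]
      exact (((hs.setTmp hd _).setTmp (by omega) _).setTmp (by omega) _).setVar i 0
    obtain ⟨s₂, r₂, v₂, m₂, f₂⟩ := Expr.runs_sum_loop ihe hd i ρ σ (ρ p) 0 s₁ hs₁'
      (by rw [← hs₁]; simp [reg_setReg, (e4 _).symm])
    refine ⟨_, runs_of_eq (init _ _ _ (.seq r₂ (.move _ _ _))) ?_, ?_, ?_, fun r hr => ?_⟩
    · simp [Expr.cost]; omega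
    · simp [reg_setReg, (e4 _).symm, v₂, ← hs₁, e6, e7, Expr.eval]
    · rw [mem_setReg, m₂, ← hs₁]; rfl
    · by_cases hri : r = 2 * i
      · subst hri
        simp [reg_setReg, f₂ (tmp (d + 1)) (e4 _).symm (by simp), ← hs₁, (e4 _).symm, e8, hs.var]
      · have g1 : r ≠ tmp d := by unfold tmp at *; omega
        have g2 : r ≠ tmp (d + 2) := by unfold tmp at *; omega
        have g3 : r ≠ tmp (d + 1) := by unfold tmp at *; omega
        simp only [reg_setReg, hri, if_false]
        rw [f₂ r hri (by omega), ← hs₁]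
        simp [reg_setReg, hri, g1, g2, g3]

theorem Represents.setLow {s : State} {ρ : ℕ → ℕ} {σ : Store} (h : Represents s ρ σ) {a : ℕ}
    (ha : a ≤ σ.b) (x : ℕ) : Represents (s.setMem a x) ρ (σ.setLow a x) where
  var := h.var
  b := h.b
  low c hc := by
    by_cases e : c = a
    · subst e; simp [State.setMem, Store.setLow]
    · simp [State.setMem, Store.setLow, e, h.low c hc]
  arr k c := by
    have e : σ.b + 1 + 16 * c + k ≠ a := by omega
    simp [State.setMem, Store.setLow, e, h.arr]

/-- Array cells lie above `b`, and cells of different arrays differ modulo 16, so a write affects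
one array entry only. -/
theorem Represents.setArr {s : State} {ρ : ℕ → ℕ} {σ : Store} (h : Represents s ρ σ)
    (k : Fin 16) (a x : ℕ) :
    Represents (s.setMem (σ.b + 1 + 16 * a + k) x) ρ (σ.setArr k a x) where
  var := h.var
  b := h.b
  low c hc := by
    have e : c ≠ σ.b + 1 + 16 * a + k := by rintro rfl; simp [Store.setArr] at hc; omega
    simp [State.setMem, Store.setArr, e, h.low c hc]
  arr l c := by
    by_cases e : l = k
    · subst e
      by_cases e : c = a
      · subst e; simp [State.setMem, Store.setArr]
      · simp [State.setMem, Store.setArr, e, h.arr]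
    · have e' : σ.b + 1 + 16 * c + l ≠ σ.b + 1 + 16 * a + k := by
        have := Fin.val_ne_of_ne e; omega
      simp [State.setMem, Store.setArr, e, e', h.arr]

theorem Store.iter_b {f : ℕ → Store → Store} (hf : ∀ j σ, (f j σ).b = σ.b) (j : ℕ) (σ : Store) :
    (iter f j σ).b = σ.b := by
  induction j with
  | zero => rfl
  | succ j ih => rw [iter, hf, ih]

theorem Prog.eval_b (c : Prog) : ∀ ρ σ, (c.eval ρ σ).b = σ.b := by
  induction c with
  | skip | out | store => intros; rfl
  | seq c d ihc ihd => intro ρ σ; rw [Prog.eval, ihd, ihc]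
  | ite e c d ihc ihd => intro ρ σ; rw [Prog.eval]; split_ifs <;> simp [*]
  | loop p i c ih => intro ρ σ; exact Store.iter_b (fun j => ih _) _ _
  | bind i e c ih => intro ρ σ; exact ih _ _

/-- The same induction as for sums, except that the body changes the store: after `j` iterations the
machine represents the `j`-th iterate, on which the cost of the next iteration depends. -/
theorem Prog.runs_for_loop {c : Prog} (hc : ∀ d, 1 ≤ d → ∀ ρ σ s, Represents s ρ σ →
      ∃ s', Runs (c.compile d) s (c.cost ρ σ) s' ∧ Represents s' ρ (c.eval ρ σ) ∧
        ∀ r, r % 2 = 1 → r < tmp d → s'.reg r = s.reg r)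
    {d : ℕ} (hd : 1 ≤ d) (i : ℕ) (ρ : ℕ → ℕ) (σ : Store) (k : ℕ) : ∀ (j : ℕ) (s : State),
    Represents s (Function.update ρ i j)
      (iter (fun j => c.eval (Function.update ρ i j)) j σ) → s.reg (tmp (d + 1)) = k →
    ∃ s', Runs (.loop (tmp (d + 1)) <| .seq (c.compile (d + 2)) <|
        .seq (.const (tmp (d + 2)) 1) <| .seq (.add (2 * i) (2 * i) (tmp (d + 2))) <|
        .sub (tmp (d + 1)) (tmp (d + 1)) (tmp (d + 2))) s
        ((∑ l ∈ range k, (c.cost (Function.update ρ i (j + l))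
          (iter (fun j => c.eval (Function.update ρ i j)) (j + l) σ) + 4)) + 1) s' ∧
      Represents s' (Function.update ρ i (j + k))
        (iter (fun j => c.eval (Function.update ρ i j)) (j + k) σ) ∧
      ∀ r, r % 2 = 1 → r < tmp (d + 1) → s'.reg r = s.reg r := by
  induction k with
  | zero => intro j s hs hk; exact ⟨s, runs_of_eq (.loop_done hk) (by simp), hs, by simp⟩
  | succ k ih =>
    intro j s hs hk
    obtain ⟨s₁, r₁, hs₁, f₁⟩ := hc (d + 2) (by omega) _ _ _ hs
    have hvar : s₁.reg (2 * i) = j := by simpa using hs₁.var i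
    have hrem : s₁.reg (tmp (d + 1)) = k + 1 := by
      rw [f₁ _ (by unfold tmp; omega) (by unfold tmp; omega), hk]
    have body := Runs.seq r₁ (.seq (.const s₁ (tmp (d + 2)) 1)
      (.seq (.add _ (2 * i) (2 * i) (tmp (d + 2)))
        (.sub _ (tmp (d + 1)) (tmp (d + 1)) (tmp (d + 2)))))
    have e1 : tmp (d + 1) ≠ tmp (d + 2) := by unfold tmp; omega
    have e4 : ∀ x, 2 * i ≠ tmp x := by unfold tmp; omega
    generalize hs₂ : State.setReg _ _ _ = s₂ at body
    simp only [reg_setReg, e1, e4, (e4 _).symm, hvar, hrem, if_true, if_false,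
      Nat.add_sub_cancel] at hs₂
    have hs₂' : Represents s₂ (Function.update ρ i (j + 1))
        (iter (fun j => c.eval (Function.update ρ i j)) (j + 1) σ) := by
      rw [← hs₂]
      have := ((hs₁.setTmp (d := d + 2) (by omega) 1).setVar i (j + 1)).setTmp
        (d := d + 1) (by omega) k
      simpa [iter] using this
    obtain ⟨s₃, r₃, hs₃, f₃⟩ := ih (j + 1) s₂ hs₂' (by rw [← hs₂]; simp [reg_setReg])
    refine ⟨s₃, runs_of_eq (.loop_step (by omega) body r₃) ?_, ?_, ?_⟩
    · rw [sum_range_succ']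
      simp only [Nat.add_zero, add_comm, add_left_comm, add_assoc]
      omega
    · rwa [add_right_comm, add_assoc] at hs₃
    · intro r hr hr'
      rw [f₃ r hr hr', ← hs₂]
      have g1 : r ≠ tmp (d + 1) := by omega
      have g2 : r ≠ tmp (d + 2) := by unfold tmp at *; omega
      have g3 : r ≠ 2 * i := by omega
      simp only [reg_setReg, g1, g2, g3, if_false]
      exact f₁ r hr (by unfold tmp at *; omega)

theorem Prog.runs_compile (c : Prog) : ∀ d, 1 ≤ d → ∀ ρ σ s, Represents s ρ σ →
    ∃ s', Runs (c.compile d) s (c.cost ρ σ) s' ∧ Represents s' ρ (c.eval ρ σ) ∧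
      ∀ r, r % 2 = 1 → r < tmp d → s'.reg r = s.reg r := by
  have frame {d r : ℕ} (hr : r < tmp d) : r ≠ tmp d ∧ r ≠ tmp (d + 1) ∧ r ≠ tmp (d + 2) ∧
      r < tmp (d + 1) := by unfold tmp at *; omega
  have lt_succ (d : ℕ) : tmp d < tmp (d + 1) := by unfold tmp; omega
  induction c with
  | skip =>
    intro d hd ρ σ s hs
    exact ⟨_, .const _ _ _, hs.setTmp hd _, fun r _ hr => by simp [reg_setReg, (frame hr).1]⟩
  | out e f =>
    intro d hd ρ σ s hs
    obtain ⟨s₁, r₁, v₁, m₁, f₁⟩ := e.runs_compile d hd ρ σ s hs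
    have hs₁ := hs.congr hd m₁ f₁
    obtain ⟨s₂, r₂, v₂, m₂, f₂⟩ := f.runs_compile (d + 1) (by omega) ρ σ s₁ hs₁
    have hs₂ := hs₁.congr (by omega) m₂ f₂
    have h : e.eval σ ρ - (e.eval σ ρ - σ.b) = min (e.eval σ ρ) σ.b := by omega
    have g : (1 : ℕ) ≠ tmp (d + 2) := by unfold tmp; omega
    have g' : tmp d ≠ tmp (d + 2) := by unfold tmp; omega
    have g'' : tmp (d + 1) ≠ tmp (d + 2) := by unfold tmp; omega
    have v₃ : s₂.reg (tmp d) = e.eval σ ρ := by rw [f₂ _ (.inr (lt_succ d)), v₁]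
    refine ⟨_, runs_of_eq (.seq r₁ (.seq r₂ (.seq (.sub _ _ _ _) (.seq (.sub _ _ _ _)
      (.store _ _ _))))) (by rw [Prog.cost]; omega), ?_, fun r hr' hr => ?_⟩
    · have := ((hs₂.setTmp (d := d + 2) (by omega) (e.eval σ ρ - σ.b)).setTmp hd
        (min (e.eval σ ρ) σ.b)).setLow (min_le_right (e.eval σ ρ) _) (f.eval σ ρ)
      simpa [reg_setReg, v₃, v₂, g', hs₂.b, h, g'', (lt_succ d).ne', Prog.eval] using this
    · simp [State.setMem, reg_setReg, (frame hr).1, (frame hr).2.2.1,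
        f₂ _ (.inr (frame hr).2.2.2), f₁ _ (.inr hr)]
  | store k e f =>
    intro d hd ρ σ s hs
    obtain ⟨s₁, r₁, v₁, m₁, f₁⟩ := e.runs_compile d hd ρ σ s hs
    have hs₁ := hs.congr hd m₁ f₁
    obtain ⟨s₂, r₂, v₂, m₂, f₂⟩ := f.runs_compile (d + 1) (by omega) ρ σ s₁ hs₁
    have hs₂ := hs₁.congr (by omega) m₂ f₂
    obtain ⟨s₃, r₃, m₃, v₃, f₃⟩ := runs_address k d (d + 2) hd (by omega) s₂
    have g'' : tmp (d + 1) ≠ tmp (d + 2) := by unfold tmp; omega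
    have hs₃ : Represents s₃ ρ σ := by
      refine ⟨fun i => ?_, ?_, ?_, ?_⟩
      · rw [f₃ _ (by unfold tmp; omega) (by unfold tmp; omega), hs₂.var]
      · rw [f₃ _ (by unfold tmp; omega) (by unfold tmp; omega), hs₂.b]
      · rw [m₃]; exact hs₂.low
      · rw [m₃]; exact hs₂.arr
    refine ⟨_, runs_of_eq (.seq r₁ (.seq r₂ (.seq r₃ (.store _ _ _))))
      (by rw [Prog.cost]; omega), ?_, fun r hr' hr => ?_⟩
    · rw [v₃, hs₂.b, f₂ _ (.inr (lt_succ d)), v₁, f₃ _ (lt_succ d).ne' g'', v₂]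
      exact hs₃.setArr k _ _
    · simp [State.setMem, f₃ _ (frame hr).1 (frame hr).2.2.1,
        f₂ _ (.inr (frame hr).2.2.2), f₁ _ (.inr hr)]
  | seq c₁ c₂ ih₁ ih₂ =>
    intro d hd ρ σ s hs
    obtain ⟨s₁, r₁, hs₁, f₁⟩ := ih₁ d hd ρ σ s hs
    obtain ⟨s₂, r₂, hs₂, f₂⟩ := ih₂ d hd ρ _ s₁ hs₁
    exact ⟨s₂, .seq r₁ r₂, hs₂, fun r h h' => (f₂ r h h').trans (f₁ r h h')⟩
  | ite e c₁ c₂ ih₁ ih₂ =>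
    intro d hd ρ σ s hs
    obtain ⟨s₁, r₁, v₁, m₁, f₁⟩ := e.runs_compile d hd ρ σ s hs
    have hs₁ := hs.congr hd m₁ f₁
    by_cases h : e.eval σ ρ = 0
    · obtain ⟨s₂, r₂, hs₂, f₂⟩ := ih₂ d hd ρ σ s₁ hs₁
      refine ⟨s₂, runs_of_eq (.seq r₁ (.ite_false (v₁.trans h) r₂)) ?_, ?_,
        fun r h h' => (f₂ r h h').trans (f₁ r (.inr h'))⟩
      · simp [Prog.cost, h]; omega
      · simpa [Prog.eval, h] using hs₂
    · obtain ⟨s₂, r₂, hs₂, f₂⟩ := ih₁ d hd ρ σ s₁ hs₁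
      refine ⟨s₂, runs_of_eq (.seq r₁ (.ite_true (by rwa [v₁]) r₂)) ?_, ?_,
        fun r h h' => (f₂ r h h').trans (f₁ r (.inr h'))⟩
      · simp [Prog.cost, h]; omega
      · simpa [Prog.eval, h] using hs₂
  | loop p i c ih =>
    intro d hd ρ σ s hs
    have e4 : ∀ x, 2 * i ≠ tmp x := by unfold tmp; omega
    have e5 : ∀ x, 2 * p ≠ tmp x := by unfold tmp; omega
    have init := fun (c : Cmd) (t : ℕ) (s' : State) h =>
      Runs.seq (.move s (tmp d) (2 * i)) (.seq (.move _ (tmp (d + 1)) (2 * p))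
        (.seq (d := c) (t₂ := t) (s₂ := s') (.const _ (2 * i) 0) h))
    generalize hs₁ : State.setReg (State.setReg _ (tmp (d + 1)) _) _ _ = s₁ at init
    simp only [reg_setReg, e5, hs.var, if_false] at hs₁
    have hs₁' : Represents s₁ (Function.update ρ i 0) σ := by
      rw [← hs₁]
      exact ((hs.setTmp hd _).setTmp (by omega) _).setVar i 0
    obtain ⟨s₂, r₂, hs₂, f₂⟩ := Prog.runs_for_loop ih hd i ρ σ (ρ p) 0 s₁ hs₁'
      (by rw [← hs₁]; simp [reg_setReg, (e4 _).symm])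
    have v : s₂.reg (tmp d) = ρ i := by
      rw [f₂ _ (by unfold tmp; omega) (lt_succ d), ← hs₁]
      simp [reg_setReg, (e4 _).symm, (lt_succ d).ne]
    refine ⟨_, runs_of_eq (init _ _ _ (.seq r₂ (.move _ _ _))) ?_, ?_, fun r hr' hr => ?_⟩
    · simp [Prog.cost]; omega
    · have := hs₂.setVar i (ρ i)
      simpa [v, Prog.eval] using this
    · have g : r ≠ 2 * i := by omega
      simp only [reg_setReg, g, if_false]
      rw [f₂ r hr' (frame hr).2.2.2, ← hs₁]
      simp [reg_setReg, g, (frame hr).1, (frame hr).2.1]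
  | bind i e c ih =>
    intro d hd ρ σ s hs
    have e4 : ∀ x, 2 * i ≠ tmp x := by unfold tmp; omega
    obtain ⟨s₁, r₁, v₁, m₁, f₁⟩ := e.runs_compile (d + 1) (by omega) ρ σ s hs
    have hs₁ := hs.congr (by omega) m₁ f₁
    have start := fun (c : Cmd) (t : ℕ) (s' : State) h =>
      Runs.seq r₁ (.seq (.move _ (tmp d) (2 * i)) (.seq (d := c) (t₂ := t) (s₂ := s')
        (.move _ (2 * i) (tmp (d + 1))) h))
    generalize hs₂ : State.setReg (State.setReg _ (tmp d) _) _ _ = s₂ at start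
    simp only [reg_setReg, (lt_succ d).ne', v₁, hs₁.var, if_false] at hs₂
    have hs₂' : Represents s₂ (Function.update ρ i (e.eval σ ρ)) σ := by
      rw [← hs₂]
      exact (hs₁.setTmp hd _).setVar i _
    obtain ⟨s₃, r₃, hs₃, f₃⟩ := ih (d + 1) (by omega) _ _ s₂ hs₂'
    have v : s₃.reg (tmp d) = ρ i := by
      rw [f₃ _ (by unfold tmp; omega) (lt_succ d), ← hs₂]
      simp [reg_setReg, (e4 _).symm]
    refine ⟨_, runs_of_eq (start _ _ _ (.seq r₃ (.move _ _ _))) ?_, ?_, fun r hr' hr => ?_⟩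
    · simp [Prog.cost]; omega
    · have := hs₃.setVar i (ρ i)
      simpa [v, Prog.eval] using this
    · have g : r ≠ 2 * i := by omega
      simp only [reg_setReg, g, if_false]
      rw [f₃ r hr' (frame hr).2.2.2, ← hs₂]
      simp [reg_setReg, g, (frame hr).1, f₁ r (.inr (frame hr).2.2.2)]

/-! ### The initial segment of the machine program -/

/-- Moves the input to the places where compiled programs expect it. -/
def prelude : Cmd :=
  .seq (.move 2 1) <| .seq (.const 1 0) <| .seq (.move 3 0) <| .seq (.const 5 1) <|
  .seq (.loop 3 (.seq (.add 1 1 0) (.sub 3 3 5))) (.add 1 1 0)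

/-- In the absence of multiplication, n * n arises by repeated addition. It leads to b = n * n + n,
so that the cells up to `b` include the matrix and the output. -/
theorem runs_prelude_loop (k : ℕ) : ∀ s : State, s.reg 5 = 1 → s.reg 3 = k →
    ∃ s', Runs (.loop 3 (.seq (.add 1 1 0) (.sub 3 3 5))) s (3 * k + 1) s' ∧
      s'.reg 1 = s.reg 1 + k * s.reg 0 ∧ s'.mem = s.mem ∧
      ∀ r, r ≠ 1 → r ≠ 3 → s'.reg r = s.reg r := by
  induction k with
  | zero => intro s _ h3; exact ⟨s, .loop_done h3, by simp, rfl, by simp⟩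
  | succ k ih =>
    intro s h5 h3
    obtain ⟨s', r, v, m, f⟩ := ih ((s.setReg 1 (s.reg 1 + s.reg 0)).setReg 3 k)
      (by simp [reg_setReg, h5]) (by simp [reg_setReg])
    have body := Runs.seq (.add s 1 1 0) (.sub _ 3 3 5)
    simp only [reg_setReg, h5, h3] at body
    refine ⟨s', runs_of_eq (.loop_step (by omega) body r) (by ring), ?_, m, ?_⟩
    · rw [v]; simp [reg_setReg]; ring
    · intro r hr hr'
      rw [f r hr hr']; simp [reg_setReg, hr, hr']

/-- The initial values of the variables. -/
def initVars (n q : ℕ) (i : ℕ) : ℕ := if i = 0 then n else if i = 1 then q else 0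

/-- The initial store. -/
noncomputable def initStore {n : ℕ} (G : SimpleGraph (Fin n)) : Store where
  b := n * n + n
  low := (input G 0).mem
  arr _ _ := 0

theorem runs_prelude {n : ℕ} (G : SimpleGraph (Fin n)) (q : ℕ) :
    ∃ s, Runs prelude (input G q) (3 * n + 6) s ∧
      Represents s (initVars n q) (initStore G) := by
  obtain ⟨s, r, v, m, f⟩ := runs_prelude_loop n
    (((((input G q).setReg 2 q).setReg 1 0).setReg 3 n).setReg 5 1)
    (by simp [reg_setReg]) (by simp [reg_setReg])
  have start := fun (c : Cmd) (t : ℕ) (s' : State) h =>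
    Runs.seq (.move (input G q) 2 1) (.seq (.const _ 1 0) (.seq (.move _ 3 0)
      (.seq (d := c) (t₂ := t) (s₂ := s') (.const _ 5 1) h)))
  have e1 : (input G q).reg 1 = q := by simp [input]
  have e0 : (input G q).reg 0 = n := by simp [input]
  simp only [reg_setReg, e1, e0] at start v
  refine ⟨_, runs_of_eq (start _ _ _ (.seq r (.add _ 1 1 0))) (by ring), ?_, ?_, ?_, ?_⟩
  · intro i
    have h1 : 2 * i ≠ 1 := by omega
    have h3 : 2 * i ≠ 3 := by omega
    have h5 : 2 * i ≠ 5 := by omega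
    have h2 : 2 * i = 2 ↔ i = 1 := by omega
    rw [reg_setReg, if_neg h1, f _ h1 h3]
    simp only [reg_setReg, h1, h3, h5, h2, if_false, input, initVars]
    split_ifs <;> omega
  · simp [reg_setReg, v, f 0, initStore, e0]
  · intro a _
    rw [mem_setReg, m]; rfl
  · intro k a
    rw [mem_setReg, m]
    simp only [State.setReg, input, initStore]
    -- The adjacency matrix lies below n * n, hence all array cells are initially 0.
    refine if_neg ?_
    rintro ⟨u, v, h, -⟩
    have h1 : n * (u + 1) ≤ n * n := Nat.mul_le_mul_left _ u.2
    have h2 := v.2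
    rw [mul_add] at h1
    omega

/-- The machine program that belongs to `c`. -/
def Prog.machine (c : Prog) : Cmd := .seq prelude (c.compile 1)

theorem Prog.runs_machine (c : Prog) {n : ℕ} (G : SimpleGraph (Fin n)) (q : ℕ) :
    ∃ s, Runs c.machine (input G q) (3 * n + 6 + c.cost (initVars n q) (initStore G)) s ∧
      Represents s (initVars n q) (c.eval (initVars n q) (initStore G)) := by
  obtain ⟨s, r, h⟩ := runs_prelude G q
  obtain ⟨s', r', h', -⟩ := c.runs_compile 1 le_rfl _ _ s h
  exact ⟨s', .seq r r', h'⟩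

/-! ### Bounds for the number of steps -/

/-- All loops of `e` run up to one of the variables in `V`, and `e` does not bind these. -/
def Expr.LoopsIn (V : List ℕ) : Expr → Prop
  | .cst _ | .var _ => True
  | .add e f | .sub e f => e.LoopsIn V ∧ f.LoopsIn V
  | .low e | .get _ e => e.LoopsIn V
  | .ite e f g => e.LoopsIn V ∧ f.LoopsIn V ∧ g.LoopsIn V
  | .sum p i e => p ∈ V ∧ i ∉ V ∧ e.LoopsIn V

def Prog.LoopsIn (V : List ℕ) : Prog → Prop
  | .skip => True
  | .out e f | .store _ e f => e.LoopsIn V ∧ f.LoopsIn V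
  | .seq c d => c.LoopsIn V ∧ d.LoopsIn V
  | .ite e c d => e.LoopsIn V ∧ c.LoopsIn V ∧ d.LoopsIn V
  | .loop p i c => p ∈ V ∧ i ∉ V ∧ c.LoopsIn V
  | .bind i e c => i ∉ V ∧ e.LoopsIn V ∧ c.LoopsIn V

/-- A bound for the number of steps if no loop runs more than `M` times. -/
def Expr.bound (M : ℕ) : Expr → ℕ
  | .cst _ | .var _ => 1
  | .add e f | .sub e f => e.bound M + f.bound M + 1
  | .low e => e.bound M + 3
  | .get _ e => e.bound M + 8
  | .ite e f g => e.bound M + 1 + (f.bound M + g.bound M)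
  | .sum _ _ e => M * (e.bound M + 5) + 6

def Prog.bound (M : ℕ) : Prog → ℕ
  | .skip => 1
  | .out e f => e.bound M + f.bound M + 3
  | .store _ e f => e.bound M + f.bound M + 8
  | .seq c d => c.bound M + d.bound M
  | .ite e c d => e.bound M + 1 + (c.bound M + d.bound M)
  | .loop _ _ c => M * (c.bound M + 4) + 5
  | .bind _ e c => e.bound M + 3 + c.bound M

theorem update_le_of_notMem {V : List ℕ} {ρ : ℕ → ℕ} {M i : ℕ} (h : ∀ p ∈ V, ρ p ≤ M)
    (hi : i ∉ V) (x : ℕ) : ∀ p ∈ V, Function.update ρ i x p ≤ M := by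
  intro p hp
  rw [Function.update_of_ne (by rintro rfl; exact hi hp)]
  exact h p hp

theorem Expr.cost_le {V : List ℕ} {M : ℕ} (σ : Store) (e : Expr) : ∀ ρ : ℕ → ℕ,
    (∀ p ∈ V, ρ p ≤ M) → e.LoopsIn V → e.cost σ ρ ≤ e.bound M := by
  induction e with
  | cst | var => intros; exact le_rfl
  | add e f ihe ihf | sub e f ihe ihf =>
    intro ρ h ok
    have := ihe ρ h ok.1
    have := ihf ρ h ok.2
    simp only [Expr.cost, Expr.bound]; omega
  | low e ih | get k e ih =>
    intro ρ h ok
    have := ih ρ h ok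
    simp only [Expr.cost, Expr.bound]; omega
  | ite e f g ihe ihf ihg =>
    intro ρ h ok
    have := ihe ρ h ok.1
    have := ihf ρ h ok.2.1
    have := ihg ρ h ok.2.2
    simp only [Expr.cost, Expr.bound]; split_ifs <;> omega
  | sum p i e ih =>
    intro ρ h ok
    simp only [Expr.cost, Expr.bound]
    refine Nat.add_le_add_right ((sum_le_card_nsmul _ _ (e.bound M + 5) fun j _ =>
      Nat.add_le_add_right (ih _ (update_le_of_notMem h ok.2.1 j) ok.2.2) 5).trans ?_) 6
    rw [card_range, smul_eq_mul]
    exact Nat.mul_le_mul_right _ (h p ok.1)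

/-- Variables in `V` are never rebound, so a bound for their initial values bounds every loop; the
result depends neither on the store nor on the branches taken. -/
theorem Prog.cost_le {V : List ℕ} {M : ℕ} (c : Prog) : ∀ (ρ : ℕ → ℕ) (σ : Store),
    (∀ p ∈ V, ρ p ≤ M) → c.LoopsIn V → c.cost ρ σ ≤ c.bound M := by
  induction c with
  | skip => intros; exact le_rfl
  | out e f | store k e f =>
    intro ρ σ h ok
    have := e.cost_le σ ρ h ok.1
    have := f.cost_le σ ρ h ok.2
    simp only [Prog.cost, Prog.bound]; omega
  | seq c d ihc ihd =>
    intro ρ σ h ok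
    exact Nat.add_le_add (ihc ρ σ h ok.1) (ihd ρ _ h ok.2)
  | ite e c d ihc ihd =>
    intro ρ σ h ok
    have := e.cost_le σ ρ h ok.1
    have := ihc ρ σ h ok.2.1
    have := ihd ρ σ h ok.2.2
    simp only [Prog.cost, Prog.bound]; split_ifs <;> omega
  | loop p i c ih =>
    intro ρ σ h ok
    simp only [Prog.cost, Prog.bound]
    refine Nat.add_le_add_right ((sum_le_card_nsmul _ _ (c.bound M + 4) fun j _ =>
      Nat.add_le_add_right (ih _ _ (update_le_of_notMem h ok.2.1 j) ok.2.2) 4).trans ?_) 5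
    rw [card_range, smul_eq_mul]
    exact Nat.mul_le_mul_right _ (h p ok.1)
  | bind i e c ih =>
    intro ρ σ h ok
    have := e.cost_le σ ρ h ok.2.1
    have := ih _ σ (update_le_of_notMem h ok.1 (e.eval σ ρ)) ok.2.2
    simp only [Prog.cost, Prog.bound]; omega

/-- The function is bounded by a polynomial. -/
def PolyBounded (f : ℕ → ℕ) : Prop := ∃ a k, ∀ M, f M ≤ a * (M + 1) ^ k

theorem PolyBounded.const (c : ℕ) : PolyBounded fun _ => c := ⟨c, 0, by simp⟩

theorem PolyBounded.id : PolyBounded fun M => M := ⟨1, 1, by simp⟩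

theorem PolyBounded.add {f g : ℕ → ℕ} (hf : PolyBounded f) (hg : PolyBounded g) :
    PolyBounded fun M => f M + g M := by
  obtain ⟨a, k, h⟩ := hf
  obtain ⟨b, l, h'⟩ := hg
  refine ⟨a + b, k + l, fun M => ?_⟩
  rw [add_mul]
  refine Nat.add_le_add ((h M).trans ?_) ((h' M).trans ?_) <;>
    exact Nat.mul_le_mul_left _ (Nat.pow_le_pow_right (by omega) (by omega))

theorem PolyBounded.mul {f g : ℕ → ℕ} (hf : PolyBounded f) (hg : PolyBounded g) :
    PolyBounded fun M => f M * g M := by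
  obtain ⟨a, k, h⟩ := hf
  obtain ⟨b, l, h'⟩ := hg
  refine ⟨a * b, k + l, fun M => (Nat.mul_le_mul (h M) (h' M)).trans_eq ?_⟩
  ring

theorem Expr.polyBounded_bound (e : Expr) : PolyBounded fun M => e.bound M := by
  induction e with
  | cst | var => exact .const 1
  | add e f ihe ihf | sub e f ihe ihf => exact (ihe.add ihf).add (.const 1)
  | low e ih => exact ih.add (.const 3)
  | get k e ih => exact ih.add (.const 8)
  | ite e f g ihe ihf ihg => exact (ihe.add (.const 1)).add (ihf.add ihg)
  | sum p i e ih => exact (PolyBounded.id.mul (ih.add (.const 5))).add (.const 6)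

theorem Prog.polyBounded_bound (c : Prog) : PolyBounded fun M => c.bound M := by
  induction c with
  | skip => exact .const 1
  | out e f => exact (e.polyBounded_bound.add f.polyBounded_bound).add (.const 3)
  | store k e f => exact (e.polyBounded_bound.add f.polyBounded_bound).add (.const 8)
  | seq c d ihc ihd => exact ihc.add ihd
  | ite e c d ihc ihd => exact (e.polyBounded_bound.add (.const 1)).add (ihc.add ihd)
  | loop p i c ih => exact (PolyBounded.id.mul (ih.add (.const 4))).add (.const 5)
  | bind i e c ih => exact (e.polyBounded_bound.add (.const 3)).add ih

/-! ### Reasoning about programs -/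

/-- The rule for loop invariants, on which the correctness of the loops rests. -/
theorem iter_induction {f : ℕ → Store → Store} {N : ℕ} (Inv : ℕ → Store → Prop) {σ : Store}
    (h0 : Inv 0 σ) (hs : ∀ j < N, ∀ σ', Inv j σ' → Inv (j + 1) (f j σ')) :
    Inv N (iter f N σ) := by
  induction N with
  | zero => exact h0
  | succ N ih => exact hs N (by omega) _ (ih fun j hj => hs j (by omega))

/-- The arrays that a program assigns to. -/
def Prog.writes : Prog → Finset (Fin 16)
  | .skip | .out _ _ => ∅
  | .store k _ _ => {k}
  | .seq c d | .ite _ c d => c.writes ∪ d.writes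
  | .loop _ _ c | .bind _ _ c => c.writes

/-- The program does not change the input cells. -/
def Prog.Silent : Prog → Prop
  | .skip | .store _ _ _ => True
  | .out _ _ => False
  | .seq c d | .ite _ c d => c.Silent ∧ d.Silent
  | .loop _ _ c | .bind _ _ c => c.Silent

/-- Together with `Prog.eval_low` this is the frame rule for stores; `writes` is a computable finite
set, so the hypothesis is settled by `decide`. -/
theorem Prog.eval_arr {k : Fin 16} (c : Prog) : ∀ ρ σ, k ∉ c.writes →
    (c.eval ρ σ).arr k = σ.arr k := by
  induction c with
  | skip | out => intros; rfl
  | store l e f =>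
    intro ρ σ h
    rw [Prog.writes, mem_singleton] at h
    simp [Prog.eval, Store.setArr, h]
  | seq c d ihc ihd =>
    intro ρ σ h
    rw [Prog.writes, mem_union, not_or] at h
    rw [Prog.eval, ihd _ _ h.2, ihc _ _ h.1]
  | ite e c d ihc ihd =>
    intro ρ σ h
    rw [Prog.writes, mem_union, not_or] at h
    rw [Prog.eval]; split_ifs <;> simp [*]
  | loop p i c ih =>
    intro ρ σ h
    exact iter_induction (fun _ σ' => σ'.arr k = σ.arr k) rfl
      fun j _ σ' e => (ih _ _ h).trans e
  | bind i e c ih => intro ρ σ h; exact ih _ _ h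

theorem Prog.eval_low (c : Prog) : ∀ ρ σ, c.Silent → (c.eval ρ σ).low = σ.low := by
  induction c with
  | skip | store => intros; rfl
  | out e f => intro ρ σ h; exact h.elim
  | seq c d ihc ihd => intro ρ σ h; rw [Prog.eval, ihd _ _ h.2, ihc _ _ h.1]
  | ite e c d ihc ihd =>
    intro ρ σ h
    rw [Prog.eval]; split_ifs
    exacts [ihc _ _ h.1, ihd _ _ h.2]
  | loop p i c ih =>
    intro ρ σ h
    exact iter_induction (fun _ σ' => σ'.low = σ.low) rfl fun j _ σ' e => (ih _ _ h).trans e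
  | bind i e c ih => intro ρ σ h; exact ih _ _ h

/-! ### Derived expressions -/

namespace Expr

/-- Nonzero means true, and truncated subtraction from 1 negates. -/
def le (e f : Expr) : Expr := .sub (.cst 1) (.sub e f)
def not (e : Expr) : Expr := .sub (.cst 1) e
def and (e f : Expr) : Expr := .ite e (.ite f (.cst 1) (.cst 0)) (.cst 0)
def or (e f : Expr) : Expr := .ite e (.cst 1) (.ite f (.cst 1) (.cst 0))
def eq (e f : Expr) : Expr := and (le e f) (le f e)
def all (p i : ℕ) (e : Expr) : Expr := not (.sum p i (not e))

/-- The quotient of `e` by the value of `b`; the variables `i` and `j` are auxiliary, and the value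
of `p` has to be an upper bound for `e`. -/
def div (p b i j : ℕ) (e : Expr) : Expr :=
  .sum p i (le (.sum b j (.add (.var i) (.cst 1))) e)

variable (σ : Store) (ρ : ℕ → ℕ)

theorem eval_le (e f : Expr) : (le e f).eval σ ρ = if e.eval σ ρ ≤ f.eval σ ρ then 1 else 0 := by
  simp only [le, Expr.eval]; split_ifs <;> omega

theorem eval_not (e : Expr) : (not e).eval σ ρ = if e.eval σ ρ = 0 then 1 else 0 := by
  simp only [not, Expr.eval]; split_ifs <;> omega

theorem eval_and (e f : Expr) :
    (and e f).eval σ ρ = if e.eval σ ρ ≠ 0 ∧ f.eval σ ρ ≠ 0 then 1 else 0 := by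
  simp only [and, Expr.eval]; split_ifs <;> simp_all

theorem eval_or (e f : Expr) :
    (or e f).eval σ ρ = if e.eval σ ρ ≠ 0 ∨ f.eval σ ρ ≠ 0 then 1 else 0 := by
  simp only [or, Expr.eval]; split_ifs <;> simp_all

theorem eval_eq (e f : Expr) : (eq e f).eval σ ρ = if e.eval σ ρ = f.eval σ ρ then 1 else 0 := by
  simp only [eq, eval_and, eval_le]; split_ifs <;> simp_all; omega

theorem eval_all (p i : ℕ) (e : Expr) : (all p i e).eval σ ρ =
    if ∀ j < ρ p, e.eval σ (Function.update ρ i j) ≠ 0 then 1 else 0 := by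
  simp only [all, eval_not, Expr.eval, sum_eq_zero_iff, mem_range]
  congr 1
  simp

theorem eval_div {p b i j : ℕ} {e : Expr} {t : ℕ} (hib : b ≠ i) (hij : i ≠ j) (hb : 0 < ρ b)
    (he : ∀ x, e.eval σ (Function.update ρ i x) = t) (ht : t ≤ ρ p) :
    (div p b i j e).eval σ ρ = t / ρ b := by
  simp only [div, Expr.eval, eval_le, he, Function.update_of_ne hib, Function.update_of_ne hij,
    Function.update_self, sum_const, card_range, smul_eq_mul, sum_boole, Nat.cast_id]
  -- The sum counts the x with (x + 1) * b ≤ t, which are those below t / b.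
  rw [← card_range (t / ρ b)]
  congr 1
  ext x
  simp only [mem_filter, mem_range, mul_comm (ρ b), ← Nat.le_div_iff_mul_le hb]
  have := Nat.div_le_self t (ρ b)
  omega

end Expr

/-! ### The colouring program -/

/-! Variables that hold parameters. -/
local notation "vN" => 0
local notation "vQ" => 1
local notation "vM" => 2
local notation "vMM" => 3
local notation "vB" => 4
local notation "vL" => 5
local notation "vR" => 6
local notation "vS" => 7
local notation "vD" => 8
local notation "vK" => 9
local notation "vP" => 10

/-! Other variables. -/
local notation "vRound" => 11
local notation "vCode" => 12
local notation "vI" => 13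
local notation "vU" => 14
local notation "vV" => 15
local notation "vW" => 16
local notation "vT" => 17
local notation "vO" => 18
local notation "vX" => 19
local notation "vY" => 20
local notation "vZ" => 21
local notation "vJ" => 22

/-! Arrays. -/
local notation "aCol" => (1 : Fin 16)
local notation "aDig" => (2 : Fin 16)
local notation "aCls" => (3 : Fin 16)
local notation "aComp" => (4 : Fin 16)
local notation "aPar" => (5 : Fin 16)
local notation "aNew" => (6 : Fin 16)
local notation "aTmp" => (7 : Fin 16)
local notation "aFound" => (8 : Fin 16)

namespace Expr

/-- Whether there is an edge between the values of `u` and `v`. -/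
def edge (u v : ℕ) : Expr := .low (.add (.sum vN vJ (.var u)) (.var v))

def cell (k : Fin 16) (u : ℕ) : Expr := .get k (.var u)

/-- The number of pairs of a digit that guesses colour `c` for a vertex, and an edge from this
vertex to `vW`. -/
def near (c : ℕ) : Expr :=
  .sum vL vI <| .sum vN vU <|
    .ite (eq (cell aDig vI) (.add (.sum vN vJ (.cst c)) (.var vU))) (edge vU vW) (.cst 0)

end Expr

namespace Prog

open _root_.LoopLang.Expr

/-- Writes the digits of `aTmp[0]` in base `vB` to `aDig`. -/
def decode : Prog :=
  .loop vL vI <| .bind vT (div vP vB vX vY (.get aTmp (.cst 0))) <|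
    .seq (.store aDig (.var vI) (.sub (.get aTmp (.cst 0)) (.sum vB vJ (.var vT))))
      (.store aTmp (.cst 0) (.var vT))

/-- Sorts the uncoloured vertices that have a neighbour with a guessed colour. -/
def classify : Prog :=
  .loop vN vW <| .store aCls (.var vW) <| .ite (cell aCol vW) (.cst 0) <|
    .ite (near 0) (.cst 1) <| .ite (near 1) (.cst 2) <| .ite (near 2) (.cst 3) (.cst 0)

/-- Joins the components `vX` and `vY`; if `vZ ≠ 0`, the sides of `vY` are swapped. -/
def merge : Prog :=
  .loop vN vW <| .ite (eq (cell aComp vW) (.var vY))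
    (.seq (.store aPar (.var vW) (.ite (.var vZ) (.sub (.cst 1) (cell aPar vW)) (cell aPar vW)))
      (.store aComp (.var vW) (.var vX))) .skip

/-- Adds the edge between `vU` and `vV` if it is inside a class and joins two components. -/
def addEdge : Prog :=
  .ite (and (and (edge vU vV) (cell aCls vU))
      (and (eq (cell aCls vU) (cell aCls vV)) (not (eq (cell aComp vU) (cell aComp vV)))))
    (.bind vX (cell aComp vU) <| .bind vY (cell aComp vV) <| .bind vZ (eq (cell aPar vU) (cell aPar vV)) merge)
    .skip

/-- Computes two sides of each component of the graph of all edges inside the classes. -/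
def bipartition : Prog :=
  .seq (.loop vN vW (.seq (.store aComp (.var vW) (.var vW)) (.store aPar (.var vW) (.cst 0))))
    (.loop vN vU (.loop vN vV addEdge))

/-- The candidate colours that come from the classes and their sides. -/
def extend : Prog :=
  .seq classify <| .seq bipartition <|
    .loop vN vW <| .store aNew (.var vW) <| .ite (cell aCls vW)
      (.sub (.add (.var vO) (.add (.add (cell aCls vW) (cell aCls vW)) (cell aPar vW))) (.cst 1)) (.cst 0)

/-- The candidate colours that are given by the digits. -/
def direct : Prog :=
  .loop vN vW <| .store aNew (.var vW) <| .add (.var vO) (.add (cell aDig vW) (.cst 1))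

end Prog

namespace Expr

/-- The candidate colours are proper. -/
def newProper : Expr :=
  all vN vU <| all vN vV <| .ite (edge vU vV)
    (.ite (cell aNew vU) (not (eq (cell aNew vU) (cell aNew vV))) (.cst 1)) (.cst 1)

/-- At least `vK` vertices have a candidate colour. -/
def newMany : Expr := le (.var vK) (.sum vN vW (.ite (cell aNew vW) (.cst 1) (.cst 0)))

/-- Each vertex has fewer than `vD` neighbours that have neither a colour nor a candidate. -/
def restSparse : Expr :=
  all vN vV <| le (.add (.sum vN vW (and (edge vV vW) (not (or (cell aCol vW) (cell aNew vW)))))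
    (.cst 1)) (.var vD)

end Expr

namespace Prog

open _root_.LoopLang.Expr

/-- Takes over the candidate colours. -/
def accept : Prog :=
  .seq (.loop vN vW (.ite (cell aNew vW) (.store aCol (.var vW) (cell aNew vW)) .skip))
    (.store aFound (.cst 0) (.cst 1))

/-- The candidate colours that belong to the number `vCode`. -/
def candidate : Prog :=
  .seq (.store aTmp (.cst 0) (.var vCode)) <| .seq decode <| .ite (.var vM) extend direct

/-- A candidate is checked before it is accepted, so a false guess that passes the check is as
useful as a true one. -/
def attempt : Prog :=
  .seq candidate <|
    .ite (and (not (.get aFound (.cst 0))) (and newProper (or newMany restSparse))) accept .skip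

/-- The colours used in round r are those above `vS` * r. The loop continues through all codes after
a success, when `aFound` merely blocks further acceptance; this is the source of the lower bound on
the time. -/
def round : Prog :=
  .bind vO (.sum vS vJ (.var vRound)) <| .seq (.store aFound (.cst 0) (.cst 0)) <|
    .loop vP vCode attempt

/-- Colours the uncoloured vertices with the colours above `vO`. -/
def greedy : Prog :=
  .loop vN vV <| .ite (cell aCol vV) .skip <| .loop vD vY <|
    .ite (.sum vN vW
        (and (edge vV vW) (eq (cell aCol vW) (.add (.var vO) (.add (.var vY) (.cst 1))))))
      .skip (.store aCol (.var vV) (.add (.var vO) (.add (.var vY) (.cst 1))))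

def output : Prog :=
  .loop vN vV <| .out (.add (.sum vN vJ (.var vN)) (.var vV)) (.sub (cell aCol vV) (.cst 1))

def main : Prog :=
  .seq (.loop vR vRound round) <| .seq (.bind vO (.sum vR vJ (.var vS)) greedy) output

/-- Computes `vB ^ vL` in `aTmp[0]`. -/
def power : Prog :=
  .seq (.store aTmp (.cst 0) (.cst 1)) <| .loop vL vI <|
    .store aTmp (.cst 0) (.sum vB vJ (.get aTmp (.cst 0)))

/-- Computes the parameters and runs `c`. -/
def withParams (c : Prog) : Prog :=
  -- Six colours in each of m rounds and 6m in the greedy phase make 12m, whence m = q / 12. The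
  -- value m = 0 selects the exhaustive search.
  .bind vT (.cst 12) <|
  .bind vM (div vQ vT vX vY (.var vQ)) <|
  .bind vMM (.sum vM vJ (.var vM)) <|
  -- A digit n * c + u below 3n guesses colour c for the vertex u, and the digit 3n guesses nothing;
  -- hence the base 3n + 1.
  .bind vB (.ite (.var vM) (.add (.add (.var vN) (.add (.var vN) (.var vN))) (.cst 1)) (.var vQ)) <|
  -- More than n / m² guesses, so that m rounds with 6m vertices per guess account for all n
  -- vertices.
  .bind vL (.ite (.var vM) (.add (div vN vMM vX vY (.var vN)) (.cst 1)) (.var vN)) <|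
  .bind vR (.ite (.var vM) (.var vM) (.cst 1)) <|
  .bind vS (.ite (.var vM) (.cst 6) (.var vQ)) <|
  .bind vI (.cst 6) <|
  .bind vD (.ite (.var vM) (.sum vI vJ (.var vM)) (.cst 0)) <|
  .bind vK (.ite (.var vM) (.sum vL vJ (.var vD)) (.var vN)) <|
  .seq power <| .bind vP (.get aTmp (.cst 0)) c

end Prog

/-! ### Semantics of the parts of the program -/

def Store.Edge (σ : Store) (n u v : ℕ) : Prop := σ.low (min (n * u + v) σ.b) ≠ 0

theorem Expr.eval_edge (σ : Store) (ρ : ℕ → ℕ) {u v : ℕ} (hu : u ≠ vJ) :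
    (Expr.edge u v).eval σ ρ = σ.low (min (ρ vN * ρ u + ρ v) σ.b) := by
  simp [Expr.edge, Expr.eval, hu]

theorem Store.setArr_arr (σ : Store) (k : Fin 16) (a x : ℕ) (l : Fin 16) :
    (σ.setArr k a x).arr l = if l = k then Function.update (σ.arr k) a x else σ.arr l := by
  simp only [Store.setArr, Function.update_apply]

theorem Prog.eval_decode (ρ : ℕ → ℕ) (σ : Store) (hB : 0 < ρ vB) (hP : σ.arr aTmp 0 ≤ ρ vP) :
    ∀ i < ρ vL, (decode.eval ρ σ).arr aDig i = σ.arr aTmp 0 / ρ vB ^ i % ρ vB := by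
  have key : (decode.eval ρ σ).arr aTmp 0 = σ.arr aTmp 0 / ρ vB ^ ρ vL ∧
      ∀ i < ρ vL, (decode.eval ρ σ).arr aDig i = σ.arr aTmp 0 / ρ vB ^ i % ρ vB := by
    refine iter_induction (fun j σ' => σ'.arr aTmp 0 = σ.arr aTmp 0 / ρ vB ^ j ∧
      ∀ i < j, σ'.arr aDig i = σ.arr aTmp 0 / ρ vB ^ i % ρ vB) ⟨by simp, by simp⟩ ?_
    rintro j hj σ' ⟨h1, h2⟩
    have hd : (Expr.div vP vB vX vY (.get aTmp (.cst 0))).eval σ' (Function.update ρ vI j) =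
        σ'.arr aTmp 0 / ρ vB :=
      Expr.eval_div _ _ (by decide) (by decide) hB (fun x => rfl)
        (by rw [h1]; exact (Nat.div_le_self _ _).trans hP)
    have hm : σ'.arr aTmp 0 - ρ vB * (σ'.arr aTmp 0 / ρ vB) = σ'.arr aTmp 0 % ρ vB :=
      Nat.sub_eq_of_eq_add (by rw [Nat.mod_add_div])
    simp only [Prog.eval, hd, Expr.eval]
    simp [Store.setArr_arr, Function.update_apply, hm]
    refine ⟨by rw [h1, Nat.div_div_eq_div_mul, pow_succ], fun i hi => ?_⟩
    split_ifs with e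
    · rw [h1, e]
    · exact h2 i (by omega)
  exact key.2


/-- The array may be filled in place provided that `e` does not read it; therefore `he` concerns all
stores that agree with `σ` outside the array `k`. -/
theorem Prog.eval_for_store {p i : ℕ} {k : Fin 16} {e : Expr} (ρ : ℕ → ℕ) (σ : Store) (g : ℕ → ℕ)
    (he : ∀ j < ρ p, ∀ σ' : Store, (∀ l ≠ k, σ'.arr l = σ.arr l) → σ'.low = σ.low → σ'.b = σ.b →
      e.eval σ' (Function.update ρ i j) = g j) (w : ℕ) :
    ((Prog.loop p i (.store k (.var i) e)).eval ρ σ).arr k w =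
      if w < ρ p then g w else σ.arr k w := by
  have key : ∀ w, ((Prog.loop p i (.store k (.var i) e)).eval ρ σ).arr k w =
        (if w < ρ p then g w else σ.arr k w) := by
    refine (iter_induction (fun j σ' => (∀ w, σ'.arr k w = if w < j then g w else σ.arr k w) ∧
      (∀ l ≠ k, σ'.arr l = σ.arr l) ∧ σ'.low = σ.low ∧ σ'.b = σ.b)
      ⟨by simp, by simp, rfl, rfl⟩ ?_).1
    rintro j hj σ' ⟨h1, h2, h3, h4⟩
    refine ⟨fun w => ?_, fun l hl => ?_, h3, h4⟩
    · simp only [Prog.eval, he j hj σ' h2 h3 h4, Expr.eval, Function.update_self,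
        Store.setArr_arr, if_true, Function.update_apply, h1]
      split_ifs <;> first | omega | simp_all
    · simp [Prog.eval, Store.setArr_arr, hl, h2 l hl]
  exact key w

theorem Prog.eval_edge_of_silent {c : Prog} (h : c.Silent) (ρ : ℕ → ℕ) (σ : Store) :
    (c.eval ρ σ).Edge = σ.Edge := by
  ext n u v
  rw [Store.Edge, Store.Edge, c.eval_b, c.eval_low ρ σ h]

/-- Some digit guesses colour `c` for a neighbour of `w`. -/
def Store.Near (σ : Store) (n L c w : ℕ) : Prop :=
  ∃ i < L, ∃ u < n, σ.arr aDig i = n * c + u ∧ σ.Edge n u w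

theorem Expr.eval_near (σ : Store) (ρ : ℕ → ℕ) (c : ℕ) :
    (Expr.near c).eval σ ρ = 0 ↔ ¬ σ.Near (ρ vN) (ρ vL) c (ρ vW) := by
  simp only [Expr.near, Expr.eval, sum_eq_zero_iff, mem_range, Store.Near,
    Store.Edge, Expr.eval_eq, Expr.cell]
  simp [Expr.eval_edge]

open Classical in
/-- The class of a vertex. -/
noncomputable def Store.cls (σ : Store) (n L w : ℕ) : ℕ :=
  if σ.arr aCol w ≠ 0 then 0 else if σ.Near n L 0 w then 1 else if σ.Near n L 1 w then 2 else
    if σ.Near n L 2 w then 3 else 0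

theorem Prog.eval_classify (ρ : ℕ → ℕ) (σ : Store) : ∀ w < ρ vN,
    (classify.eval ρ σ).arr aCls w = σ.cls (ρ vN) (ρ vL) w := by
  intro w hw
  have := Prog.eval_for_store (p := vN) (i := vW) (k := aCls)
    (e := .ite (.cell aCol vW) (.cst 0) <|
    .ite (.near 0) (.cst 1) <| .ite (.near 1) (.cst 2) <| .ite (.near 2) (.cst 3) (.cst 0))
    ρ σ (σ.cls (ρ vN) (ρ vL)) (by
      classical
      intro j _ σ' h hl hb
      have hn : ∀ c, σ'.Near (ρ vN) (ρ vL) c j ↔ σ.Near (ρ vN) (ρ vL) c j := by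
        simp [Store.Near, Store.Edge, h aDig (by decide), hl, hb]
      simp only [Expr.eval, Expr.cell, Store.cls]
      simp [Expr.eval_near, hn, h aCol (by decide)]) w
  rw [if_pos hw] at this
  exact this

/-- The relabelling is done in place, but iteration w reads and writes only entries of w, so each
test sees the original value. -/
theorem Prog.eval_merge (ρ : ℕ → ℕ) (σ : Store) : ∀ w < ρ vN,
    (merge.eval ρ σ).arr aComp w = (if σ.arr aComp w = ρ vY then ρ vX else σ.arr aComp w) ∧
    (merge.eval ρ σ).arr aPar w = (if σ.arr aComp w = ρ vY ∧ ρ vZ ≠ 0 then 1 - σ.arr aPar w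
      else σ.arr aPar w) := by
  have key := iter_induction (N := ρ vN) (σ := σ) (f := fun j =>
    (Prog.ite (.eq (.cell aComp vW) (.var vY))
    (.seq (.store aPar (.var vW) (.ite (.var vZ) (.sub (.cst 1) (.cell aPar vW)) (.cell aPar vW)))
      (.store aComp (.var vW) (.var vX))) .skip).eval (Function.update ρ vW j)) (fun j σ' => ∀ w,
      σ'.arr aComp w = (if w < j ∧ σ.arr aComp w = ρ vY then ρ vX else σ.arr aComp w) ∧
      σ'.arr aPar w = (if w < j ∧ σ.arr aComp w = ρ vY ∧ ρ vZ ≠ 0 then 1 - σ.arr aPar w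
      else σ.arr aPar w)) (by simp) (by
      intro j hj σ' h w
      have hj1 := (h j).1
      have hj2 := (h j).2
      simp only [lt_irrefl, false_and, if_false] at hj1 hj2
      by_cases e : σ.arr aComp j = ρ vY
      · simp [Prog.eval, Expr.eval, Expr.eval_eq, Expr.cell, hj1, hj2, e, Store.setArr_arr,
          Function.update_apply, h w]
        constructor
        · split_ifs <;> first | omega | simp_all
        · split_ifs <;> first | omega | simp_all
      · simp [Prog.eval, Expr.eval, Expr.eval_eq, Expr.cell, hj1, e, h w]
        have : ∀ P : Prop, (w < j ∧ σ.arr aComp w = ρ vY ∧ P) ↔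
            (w ≤ j ∧ σ.arr aComp w = ρ vY ∧ P) := by
          intro P
          constructor
          · rintro ⟨a, b⟩; exact ⟨by omega, b⟩
          · rintro ⟨a, b, c⟩
            refine ⟨?_, b, c⟩
            rcases a.lt_or_eq with a | rfl
            exacts [a, absurd b e]
        have h1 := this True
        simp only [and_true] at h1
        simp only [h1, this, and_self])
  intro w hw
  have := key w
  simp only [hw, true_and] at this
  exact this

/-- There is an edge inside a class. -/
def Store.Inner (σ : Store) (n u v : ℕ) : Prop :=
  σ.Edge n u v ∧ σ.arr aCls u ≠ 0 ∧ σ.arr aCls u = σ.arr aCls v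

/-- On each component the sides agree with `g`. -/
def Store.Consistent (σ : Store) (n : ℕ) (g : ℕ → Prop) : Prop :=
  ∀ u < n, ∀ v < n, σ.arr aComp u = σ.arr aComp v → ((g u ↔ g v) ↔ σ.arr aPar u = σ.arr aPar v)

/-- On each component the sides agree with any admissible two-colouring `g` up to an exchange. If
`g` separates the ends of the new edge, then exchanging the sides of one of the joined components
exactly when both ends have the same side preserves this. -/
theorem Prog.eval_addEdge (ρ : ℕ → ℕ) (σ : Store) (hu : ρ vU < ρ vN) (hv : ρ vV < ρ vN)
    (hpar : ∀ w < ρ vN, σ.arr aPar w ≤ 1) :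
    (∀ w < ρ vN, (addEdge.eval ρ σ).arr aPar w ≤ 1) ∧
    (∀ x < ρ vN, ∀ y < ρ vN, σ.arr aComp x = σ.arr aComp y →
      (addEdge.eval ρ σ).arr aComp x = (addEdge.eval ρ σ).arr aComp y) ∧
    (σ.Inner (ρ vN) (ρ vU) (ρ vV) →
      (addEdge.eval ρ σ).arr aComp (ρ vU) = (addEdge.eval ρ σ).arr aComp (ρ vV)) ∧
    ∀ g : ℕ → Prop, (σ.Inner (ρ vN) (ρ vU) (ρ vV) → (g (ρ vU) ↔ ¬ g (ρ vV))) →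
      σ.Consistent (ρ vN) g → (addEdge.eval ρ σ).Consistent (ρ vN) g := by
  by_cases h : σ.Inner (ρ vN) (ρ vU) (ρ vV) ∧ σ.arr aComp (ρ vU) ≠ σ.arr aComp (ρ vV)
  · have e : addEdge.eval ρ σ = merge.eval (Function.update (Function.update (Function.update ρ
        vX (σ.arr aComp (ρ vU))) vY (σ.arr aComp (ρ vV)))
        vZ (if σ.arr aPar (ρ vU) = σ.arr aPar (ρ vV) then 1 else 0)) σ := by
      obtain ⟨⟨h1, h2, h3⟩, h4⟩ := h
      rw [Store.Edge] at h1
      simp [addEdge, Prog.eval, Expr.eval_and, Expr.eval_not, Expr.eval_eq, Expr.eval_edge,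
        Expr.cell, Expr.eval, h1, h2, ← h3, h4]
    have m := Prog.eval_merge (Function.update (Function.update (Function.update ρ
        vX (σ.arr aComp (ρ vU))) vY (σ.arr aComp (ρ vV)))
        vZ (if σ.arr aPar (ρ vU) = σ.arr aPar (ρ vV) then 1 else 0)) σ
    rw [← e] at m
    simp at m
    obtain ⟨mu, mu'⟩ := m _ hu
    obtain ⟨mv, mv'⟩ := m _ hv
    refine ⟨fun w hw => ?_, fun x hx y hy hxy => ?_, fun _ => ?_, fun g hg hc => ?_⟩
    · have := hpar w hw
      rw [(m w hw).2]; split_ifs <;> omega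
    · rw [(m x hx).1, (m y hy).1, hxy]
    · rw [mu, mv]; simp
    · intro x hx y hy hxy
      rw [(m x hx).1, (m y hy).1] at hxy
      rw [(m x hx).2, (m y hy).2]
      have hg := hg h.1
      have px := hpar x hx
      have py := hpar y hy
      have pu := hpar _ hu
      have pv := hpar _ hv
      have c1 := hc x hx y hy
      have c2 := hc x hx _ hu
      have c3 := hc x hx _ hv
      have c4 := hc y hy _ hu
      have c5 := hc y hy _ hv
      -- The cases tell which of the vertices x and y come from the component whose sides may have
      -- been exchanged.
      by_cases ex : σ.arr aComp x = σ.arr aComp (ρ vV) <;>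
      by_cases ey : σ.arr aComp y = σ.arr aComp (ρ vV)
      · have c1 := c1 (ex.trans ey.symm)
        simp only [ex, ey, true_and]
        split_ifs <;> rw [c1]
        omega
      · simp only [ex, ey, true_and, false_and, if_true, if_false] at hxy ⊢
        have c3 := c3 ex
        have c4 := c4 hxy.symm
        split_ifs with hz
        · by_cases gx : g x <;> by_cases gy : g y <;> by_cases gv : g (ρ vV) <;>
            simp [gx, gy, gv, hg] at c3 c4 ⊢ <;> omega
        · by_cases gx : g x <;> by_cases gy : g y <;> by_cases gv : g (ρ vV) <;>
            simp [gx, gy, gv, hg] at c3 c4 ⊢ <;> omega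
      · simp only [ex, ey, true_and, false_and, if_true, if_false] at hxy ⊢
        have c5 := c5 ey
        have c2 := c2 hxy
        split_ifs with hz
        · by_cases gx : g x <;> by_cases gy : g y <;> by_cases gv : g (ρ vV) <;>
            simp [gx, gy, gv, hg] at c5 c2 ⊢ <;> omega
        · by_cases gx : g x <;> by_cases gy : g y <;> by_cases gv : g (ρ vV) <;>
            simp [gx, gy, gv, hg] at c5 c2 ⊢ <;> omega
      · simp only [ex, ey, false_and, if_false] at hxy ⊢
        exact c1 hxy
  · have e : addEdge.eval ρ σ = σ := by
      simp only [Store.Inner, Store.Edge] at h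
      simp [addEdge, Prog.eval, Expr.eval_and, Expr.eval_not, Expr.eval_eq, Expr.eval_edge,
        Expr.cell, Expr.eval]
      intro h1 h2 h3 h4
      exact absurd ⟨⟨h1, h2, by by_contra e; simp [e] at h3⟩, fun e => by simp [e] at h4⟩ h
    rw [e]
    refine ⟨hpar, fun _ _ _ _ h => h, fun h' => ?_, fun _ _ h => h⟩
    by_contra h''
    exact h ⟨h', h''⟩

theorem Store.inner_congr {σ σ' : Store} (h1 : σ'.Edge = σ.Edge) (h2 : σ'.arr aCls = σ.arr aCls)
    (n u v : ℕ) : σ'.Inner n u v ↔ σ.Inner n u v := by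
  simp [Store.Inner, h1, h2]

/-- The program does not know `g`, so the invariant is stated for all admissible `g` at once. In the
end the ends of an inner edge lie in one component, where the sides agree with `g`, and `g`
separates them. -/
theorem Prog.eval_bipartition (ρ : ℕ → ℕ) (σ : Store) :
    (∀ w < ρ vN, (bipartition.eval ρ σ).arr aPar w ≤ 1) ∧
    ∀ g : ℕ → Prop, (∀ u < ρ vN, ∀ v < ρ vN, σ.Inner (ρ vN) u v → (g u ↔ ¬ g v)) →
      ∀ u < ρ vN, ∀ v < ρ vN, σ.Inner (ρ vN) u v →
        (bipartition.eval ρ σ).arr aPar u ≠ (bipartition.eval ρ σ).arr aPar v := by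
  set c₀ : Prog := .loop vN vW (.seq (.store aComp (.var vW) (.var vW))
    (.store aPar (.var vW) (.cst 0))) with hc₀
  set n := ρ vN with hn
  have init : ∀ w < n, (c₀.eval ρ σ).arr aComp w = w ∧ (c₀.eval ρ σ).arr aPar w = 0 := by
    refine iter_induction (fun j σ' => ∀ w < j, σ'.arr aComp w = w ∧ σ'.arr aPar w = 0)
      (by simp) fun j hj σ' h w hw => ?_
    simp [Prog.eval, Expr.eval, Store.setArr_arr, Function.update_apply]
    by_cases e : w = j
    · simp [e]
    · simpa [e] using h w (by omega)
  -- The pairs treated so far are those that precede (u', v') lexicographically.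
  let Inv (u' v' : ℕ) (σ' : Store) : Prop := σ'.Edge = σ.Edge ∧ σ'.arr aCls = σ.arr aCls ∧
    (∀ w < n, σ'.arr aPar w ≤ 1) ∧
    (∀ u < n, ∀ v < n, σ.Inner n u v → u < u' ∨ u = u' ∧ v < v' →
      σ'.arr aComp u = σ'.arr aComp v) ∧
    ∀ g : ℕ → Prop, (∀ u < n, ∀ v < n, σ.Inner n u v → (g u ↔ ¬ g v)) → σ'.Consistent n g
  have start : Inv 0 0 (c₀.eval ρ σ) := by
    refine ⟨Prog.eval_edge_of_silent (by simp [Prog.Silent, hc₀]) _ _,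
      Prog.eval_arr _ _ _ (by decide), fun w hw => by simp [init w hw], by simp, ?_⟩
    intro g _ u hu v hv huv
    rw [(init u hu).1, (init v hv).1] at huv
    simp [huv]
  have step : ∀ u' < n, ∀ v' < n, ∀ σ', Inv u' v' σ' → Inv u' (v' + 1)
      (addEdge.eval (Function.update (Function.update ρ vU u') vV v') σ') := by
    rintro u' hu' v' hv' σ' ⟨i1, i2, i3, i4, i5⟩
    obtain ⟨a1, a2, a3, a4⟩ := Prog.eval_addEdge
      (Function.update (Function.update ρ vU u') vV v') σ'
      (by simpa using hu') (by simpa using hv') (by simpa using i3)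
    simp only [ne_eq, not_false_eq_true, Function.update_of_ne,
      Function.update_self, OfNat.zero_ne_ofNat, Nat.reduceEqDiff, ← hn,
      Store.inner_congr i1 i2] at a1 a2 a3 a4
    refine ⟨(Prog.eval_edge_of_silent (by simp [Prog.Silent, addEdge, merge]) _ _).trans i1,
      (Prog.eval_arr _ _ _ (by decide)).trans i2, a1, ?_, fun g hg => ?_⟩
    · intro u hu v hv huv hlt
      by_cases e : u = u' ∧ v = v'
      · rw [e.1, e.2] at huv ⊢
        exact a3 huv
      · exact a2 u hu v hv (i4 u hu v hv huv (by omega))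
    · exact a4 g (hg u' hu' v' hv') (i5 g hg)
  have outer : Inv n 0 (bipartition.eval ρ σ) := by
    refine iter_induction (fun u' σ' => Inv u' 0 σ') start fun u' hu' σ' h => ?_
    have inner : Inv u' n ((Prog.loop vN vV addEdge).eval (Function.update ρ vU u') σ') :=
      iter_induction (N := n) (fun v' σ' => Inv u' v' σ') h fun v' hv' σ' h =>
        step u' hu' v' hv' σ' h
    refine ⟨inner.1, inner.2.1, inner.2.2.1, fun u hu v hv huv hlt => ?_, inner.2.2.2.2⟩
    exact inner.2.2.2.1 u hu v hv huv (by omega)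
  refine ⟨outer.2.2.1, fun g hg u hu v hv huv e => ?_⟩
  have h1 := outer.2.2.2.1 u hu v hv huv (.inl hu)
  have h2 := outer.2.2.2.2 g hg u hu v hv h1
  have h3 := hg u hu v hv huv
  tauto

theorem Store.cls_le (σ : Store) (n L w : ℕ) : σ.cls n L w ≤ 3 := by
  unfold Store.cls; split_ifs <;> omega

theorem Store.cls_ne_zero {σ : Store} {n L w : ℕ} (h : σ.cls n L w ≠ 0) :
    σ.arr aCol w = 0 ∧ σ.Near n L (σ.cls n L w - 1) w := by
  unfold Store.cls at *; split_ifs at * <;> simp_all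

theorem Store.cls_ne_zero_iff {σ : Store} {n L w : ℕ} :
    σ.cls n L w ≠ 0 ↔ σ.arr aCol w = 0 ∧ ∃ c < 3, σ.Near n L c w := by
  refine ⟨fun h => ?_, ?_⟩
  · have := σ.cls_le n L w
    exact ⟨(Store.cls_ne_zero h).1, _, by omega, (Store.cls_ne_zero h).2⟩
  · rintro ⟨h, c, hc, h'⟩
    unfold Store.cls
    interval_cases c <;> split_ifs <;> simp_all

/-- The candidate colours are proper. -/
def Store.NewProper (σ : Store) (n : ℕ) : Prop :=
  ∀ u < n, ∀ v < n, σ.Edge n u v → σ.arr aNew u ≠ 0 → σ.arr aNew u ≠ σ.arr aNew v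

/-- A vertex of class k has a neighbour guessed to have colour k - 1. If the guesses are true of
`f`, then `f` takes at most two values on the class, and so it supplies the two-colouring that the
bipartition needs. The first two claims hold for arbitrary guesses. -/
theorem Prog.eval_extend (ρ : ℕ → ℕ) (σ : Store) :
    (∀ w < ρ vN, (extend.eval ρ σ).arr aNew w ≠ 0 → σ.arr aCol w = 0 ∧
      ρ vO < (extend.eval ρ σ).arr aNew w ∧ (extend.eval ρ σ).arr aNew w ≤ ρ vO + 6) ∧
    (∀ w < ρ vN, (extend.eval ρ σ).arr aNew w ≠ 0 ↔
      σ.arr aCol w = 0 ∧ ∃ c < 3, σ.Near (ρ vN) (ρ vL) c w) ∧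
    ∀ f : ℕ → ℕ, (∀ u < ρ vN, f u < 3) →
      (∀ u < ρ vN, ∀ v < ρ vN, σ.Edge (ρ vN) u v → f u ≠ f v) →
      (∀ i < ρ vL, ∀ c < 3, ∀ u < ρ vN, σ.arr aDig i = ρ vN * c + u → f u = c) →
      (extend.eval ρ σ).NewProper (ρ vN) := by
  set n := ρ vN with hn
  set σ₁ := classify.eval ρ σ with h₁
  set σ₂ := bipartition.eval ρ σ₁ with h₂
  have b := Prog.eval_bipartition ρ σ₁
  rw [← h₂, ← hn] at b
  obtain ⟨b1, b2⟩ := b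
  have cls : ∀ w < n, σ₁.arr aCls w = σ.cls n (ρ vL) w := Prog.eval_classify ρ σ
  have cls' : σ₂.arr aCls = σ₁.arr aCls := Prog.eval_arr _ _ _ (by decide)
  have edge₁ : σ₁.Edge = σ.Edge := Prog.eval_edge_of_silent (by simp [Prog.Silent, classify]) _ _
  have hsil : extend.Silent := by
    simp [Prog.Silent, extend, classify, bipartition, addEdge, merge]
  have edge : (extend.eval ρ σ).Edge = σ.Edge := Prog.eval_edge_of_silent hsil _ _
  have new : ∀ w < n, (extend.eval ρ σ).arr aNew w = if σ₁.arr aCls w ≠ 0 then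
      ρ vO + (σ₁.arr aCls w + σ₁.arr aCls w + σ₂.arr aPar w) - 1 else 0 := by
    intro w hw
    have := Prog.eval_for_store (p := vN) (i := vW) (k := aNew)
      (e := .ite (.cell aCls vW) (.sub (.add (.var vO)
        (.add (.add (.cell aCls vW) (.cell aCls vW)) (.cell aPar vW))) (.cst 1)) (.cst 0))
      ρ σ₂ (fun w => if σ₁.arr aCls w ≠ 0 then
        ρ vO + (σ₁.arr aCls w + σ₁.arr aCls w + σ₂.arr aPar w) - 1 else 0) (by
        intro j _ σ' h _ _
        simp [Expr.eval, Expr.cell, h aCls (by decide), h aPar (by decide), cls']) w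
    rw [if_pos hw] at this
    exact this
  have main : ∀ w < n, (extend.eval ρ σ).arr aNew w ≠ 0 ↔ σ.cls n (ρ vL) w ≠ 0 := by
    intro w hw
    rw [new w hw, cls w hw]
    by_cases h : σ.cls n (ρ vL) w = 0
    · simp [h]
    · rw [if_pos h]; omega
  refine ⟨fun w hw h => ?_, fun w hw => ?_, fun f hf hfE hX u hu v hv huv hu0 huv' => ?_⟩
  · have h' := (main w hw).1 h
    refine ⟨(Store.cls_ne_zero h').1, ?_⟩
    have := σ.cls_le n (ρ vL) w
    have := b1 w hw
    rw [new w hw, cls w hw, if_pos h']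
    omega
  · rw [main w hw, Store.cls_ne_zero_iff]
  · rw [edge] at huv
    have hv0 := hu0
    rw [huv'] at hv0
    have hu1 := (main u hu).1 hu0
    have hv1 := (main v hv).1 hv0
    have pu := b1 u hu
    have pv := b1 v hv
    rw [new u hu, new v hv, cls u hu, cls v hv, if_pos hu1, if_pos hv1] at huv'
    -- Since sides are at most 1, the number 2 * class + side determines the class.
    have hcls : σ.cls n (ρ vL) u = σ.cls n (ρ vL) v := by omega
    -- On class k the possible values of `f` are k % 3 and (k + 1) % 3, so equality with k % 3 is a
    -- two-colouring.
    refine b2 (fun w => f w = σ.cls n (ρ vL) w % 3) ?_ u hu v hv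
      ⟨by rwa [edge₁], by rwa [cls u hu], by rw [cls u hu, cls v hv, hcls]⟩ (by omega)
    rintro x hx y hy ⟨i1, i2, i3⟩
    rw [edge₁] at i1
    rw [cls x hx] at i2
    rw [cls x hx, cls y hy] at i3
    have key : ∀ w < n, σ.cls n (ρ vL) w ≠ 0 → f w ≠ σ.cls n (ρ vL) w - 1 := by
      intro w hw h
      obtain ⟨-, i, hi, z, hz, hd, he⟩ := Store.cls_ne_zero h
      have := σ.cls_le n (ρ vL) w
      rw [← hX i hi _ (by omega) z hz hd]
      exact (hfE z hz w hw he).symm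
    have kx := key x hx i2
    have ky := key y hy (by rwa [← i3])
    have := hfE x hx y hy i1
    have := hf x hx
    have := hf y hy
    have := σ.cls_le n (ρ vL) x
    rw [← i3] at ky ⊢
    omega

theorem Prog.eval_direct (ρ : ℕ → ℕ) (σ : Store) : ∀ w < ρ vN,
    (direct.eval ρ σ).arr aNew w = ρ vO + (σ.arr aDig w + 1) := by
  intro w hw
  have := Prog.eval_for_store (p := vN) (i := vW) (k := aNew)
    (e := .add (.var vO) (.add (.cell aDig vW) (.cst 1))) ρ σ
    (fun w => ρ vO + (σ.arr aDig w + 1)) (by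
      intro j _ σ' h _ _
      simp [Expr.eval, Expr.cell, h aDig (by decide)]) w
  rw [if_pos hw] at this
  exact this

open Classical in
/-- Many vertices have a candidate colour, or few neighbours of each vertex remain. -/
def Store.Progress (σ : Store) (n d K : ℕ) : Prop :=
  K ≤ #{w ∈ range n | σ.arr aNew w ≠ 0} ∨
    ∀ v < n, #{w ∈ range n | σ.Edge n v w ∧ σ.arr aCol w = 0 ∧ σ.arr aNew w = 0} < d

theorem boole_ne_zero (P : Prop) [Decidable P] : (if P then 1 else 0) ≠ 0 ↔ P := by simp

theorem Expr.eval_newProper (ρ : ℕ → ℕ) (σ : Store) :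
    Expr.newProper.eval σ ρ ≠ 0 ↔ σ.NewProper (ρ vN) := by
  rw [Expr.newProper, Expr.eval_all, boole_ne_zero]
  refine forall₂_congr fun u _ => ?_
  rw [Expr.eval_all, boole_ne_zero]
  refine forall₂_congr fun v _ => ?_
  simp only [Expr.eval, Expr.eval_edge (u := vU) _ _ (by decide), Expr.eval_not, Expr.eval_eq,
    Expr.cell, Store.Edge]
  simp
  split_ifs <;> simp_all

theorem Expr.eval_progress (ρ : ℕ → ℕ) (σ : Store) :
    (Expr.or .newMany .restSparse).eval σ ρ ≠ 0 ↔ σ.Progress (ρ vN) (ρ vD) (ρ vK) := by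
  classical
  rw [Expr.eval_or]
  have h1 : Expr.newMany.eval σ ρ ≠ 0 ↔ ρ vK ≤ #{w ∈ range (ρ vN) | σ.arr aNew w ≠ 0} := by
    rw [Expr.newMany, Expr.eval_le, card_filter]
    simp [Expr.eval, Expr.cell]
  have h2 : Expr.restSparse.eval σ ρ ≠ 0 ↔ ∀ v < ρ vN,
      #{w ∈ range (ρ vN) | σ.Edge (ρ vN) v w ∧ σ.arr aCol w = 0 ∧ σ.arr aNew w = 0} < ρ vD := by
    rw [Expr.restSparse, Expr.eval_all, boole_ne_zero]
    refine forall₂_congr fun v _ => ?_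
    have e (w) : (Expr.and (.edge vV vW) (.not (.or (.cell aCol vW) (.cell aNew vW)))).eval σ
        (Function.update (Function.update ρ vV v) vW w) =
        if σ.Edge (ρ vN) v w ∧ σ.arr aCol w = 0 ∧ σ.arr aNew w = 0 then 1 else 0 := by
      rw [Expr.eval_and]
      refine if_congr ?_ rfl rfl
      rw [Expr.eval_not, boole_ne_zero, Expr.eval_edge _ _ (by decide), Expr.eval_or,
        ite_eq_right_iff]
      simp [Expr.cell, Expr.eval, Store.Edge]
    rw [Expr.eval_le, boole_ne_zero, card_filter, Nat.lt_iff_add_one_le]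
    simp only [Expr.eval, e]
    simp
  rw [boole_ne_zero, h1, h2, Store.Progress]

theorem Prog.eval_accept (ρ : ℕ → ℕ) (σ : Store) :
    (∀ w < ρ vN, (accept.eval ρ σ).arr aCol w =
      if σ.arr aNew w ≠ 0 then σ.arr aNew w else σ.arr aCol w) ∧
    (accept.eval ρ σ).arr aFound 0 = 1 := by
  refine ⟨?_, by simp [accept, Prog.eval, Expr.eval, Store.setArr_arr]⟩
  have key := iter_induction (N := ρ vN) (σ := σ) (f := fun j =>
    (Prog.ite (.cell aNew vW) (.store aCol (.var vW) (.cell aNew vW)) .skip).eval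
      (Function.update ρ vW j))
    (fun j σ' => σ'.arr aNew = σ.arr aNew ∧ ∀ w, σ'.arr aCol w =
      if w < j ∧ σ.arr aNew w ≠ 0 then σ.arr aNew w else σ.arr aCol w) (by simp) (by
    rintro j hj σ' ⟨h1, h2⟩
    by_cases e : σ.arr aNew j = 0
    · simp only [Prog.eval, Expr.eval, Expr.cell, h1, e, Function.update_self]
      simp [h1, h2]
      intro w
      have : (w < j ∧ σ.arr aNew w ≠ 0) ↔ (w ≤ j ∧ σ.arr aNew w ≠ 0) := by
        refine ⟨fun ⟨a, b⟩ => ⟨a.le, b⟩, fun ⟨a, b⟩ => ⟨lt_of_le_of_ne a ?_, b⟩⟩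
        rintro rfl; exact b e
      simp only [ne_eq] at this
      simp only [this]
    · simp only [Prog.eval, Expr.eval, Expr.cell, h1, Function.update_self]
      simp [Store.setArr_arr, h1, h2, Function.update_apply, e]
      intro w
      split_ifs <;> first | omega | simp_all)
  intro w hw
  have := key.2 w
  simp only [hw, true_and] at this
  rw [← this]
  simp [accept, Prog.eval, Store.setArr_arr]

/-! ### The combinatorial core -/

open Classical in
/-- Greedy choice of vertices with many uncoloured neighbours. -/
theorem exists_digits {n d : ℕ} (E : ℕ → ℕ → Prop) (U : ℕ → Prop) (f : ℕ → ℕ)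
    (hf : ∀ u < n, f u < 3) (k : ℕ) :
    ∃ X : ℕ → ℕ, (∀ i, X i ≤ 3 * n) ∧
      (∀ i < k, ∀ c < 3, ∀ u < n, X i = n * c + u → f u = c) ∧
      (k * d ≤ #{w ∈ range n | U w ∧ ∃ c < 3, ∃ i < k, ∃ u < n, X i = n * c + u ∧ E u w} ∨
        ∀ v < n, #{w ∈ range n | E v w ∧ U w ∧
          ¬ ∃ c < 3, ∃ i < k, ∃ u < n, X i = n * c + u ∧ E u w} < d) := by
  induction k with
  | zero => exact ⟨fun _ => 3 * n, by simp, by simp, .inl (by simp)⟩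
  | succ k ih =>
    obtain ⟨X, h1, h2, h3⟩ := ih
    have pad : ∀ c < 3, ∀ u < n, 3 * n ≠ n * c + u := by
      intro c hc u hu
      interval_cases c <;> omega
    -- If every vertex has fewer than `d` uncovered neighbours, the padding digit 3n preserves this.
    -- Otherwise a vertex with at least `d` of them is guessed with its true colour; these
    -- neighbours are disjoint from the ones counted before.
    by_cases hsp : ∀ v < n, #{w ∈ range n | E v w ∧ U w ∧
          ¬ ∃ c < 3, ∃ i < k, ∃ u < n, X i = n * c + u ∧ E u w} < d
    · refine ⟨Function.update X k (3 * n), fun i => ?_, fun i hi c hc u hu h => ?_, .inr ?_⟩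
      · by_cases e : i = k
        · simp [e]
        · simp [e, h1]
      · by_cases e : i = k
        · subst e; simp at h; exact (pad c hc u hu h).elim
        · rw [Function.update_of_ne e] at h
          exact h2 i (by omega) c hc u hu h
      · intro v hv
        refine (card_le_card ?_).trans_lt (hsp v hv)
        intro w
        simp only [mem_filter]
        rintro ⟨a, b, e, h⟩
        refine ⟨a, b, e, ?_⟩
        rintro ⟨c, hc, i, hi, u, hu, hX, hE⟩
        exact h ⟨c, hc, i, by omega, u, hu, by rwa [Function.update_of_ne (by omega)], hE⟩
    · have h3 := h3.resolve_right hsp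
      push Not at hsp
      obtain ⟨v, hv, hvd⟩ := hsp
      have uniq : ∀ c < 3, ∀ u < n, n * f v + v = n * c + u → u = v ∧ c = f v := by
        intro c _ u hu h
        have e1 : (n * f v + v) % n = v := by rw [Nat.mul_add_mod, Nat.mod_eq_of_lt hv]
        have e2 : (n * c + u) % n = u := by rw [Nat.mul_add_mod, Nat.mod_eq_of_lt hu]
        have e : u = v := by rw [← e2, ← h, e1]
        refine ⟨e, ?_⟩
        subst e
        exact (Nat.eq_of_mul_eq_mul_left (by omega) (Nat.add_right_cancel h)).symm
      refine ⟨Function.update X k (n * f v + v), fun i => ?_, fun i hi c hc u hu h => ?_, .inl ?_⟩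
      · by_cases e : i = k
        · have := hf v hv
          simp only [e, Function.update_self]
          interval_cases f v <;> omega
        · simp [e, h1]
      · by_cases e : i = k
        · subst e; simp at h
          obtain ⟨rfl, rfl⟩ := uniq c hc u hu h; rfl
        · rw [Function.update_of_ne e] at h
          exact h2 i (by omega) c hc u hu h
      · rw [add_mul, one_mul]
        refine (Nat.add_le_add h3 hvd).trans ?_
        rw [← card_union_of_disjoint]
        · refine card_le_card ?_
          intro w
          simp only [mem_union, mem_filter]
          rintro (⟨a, b, c, hc, i, hi, u, hu, hX, hE⟩ | ⟨a, b, e, -⟩)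
          · exact ⟨a, b, c, hc, i, by omega, u, hu,
              by rwa [Function.update_of_ne (by omega)], hE⟩
          · exact ⟨a, e, f v, hf v hv, k, by omega, v, hv, by simp, b⟩
        · rw [disjoint_left]
          intro w
          simp only [mem_filter]
          rintro ⟨-, -, c, hc, i, hi, u, hu, hX, hE⟩ ⟨-, -, -, h'⟩
          exact h' c hc i hi u hu hX hE

theorem exists_code {B L : ℕ} (X : ℕ → ℕ) (hX : ∀ i < L, X i < B) :
    ∃ a < B ^ L, ∀ i < L, a / B ^ i % B = X i := by
  let x : Fin L → Fin B := fun i => ⟨X i, hX i i.2⟩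
  refine ⟨finFunctionFinEquiv x, (finFunctionFinEquiv x).2, fun i hi => ?_⟩
  have := finFunctionFinEquiv_symm_apply_val (finFunctionFinEquiv x) ⟨i, hi⟩
  rw [Equiv.symm_apply_apply] at this
  exact this.symm

/-! ### Colouring in rounds: the invariant and its preservation. -/

/-- The parameters are set for the exhaustive search (`vM = 0`) or for the search in rounds. -/
structure Params (ρ : ℕ → ℕ) : Prop where
  mode : (ρ vM = 0 ∧ ρ vB = ρ vS ∧ 3 ≤ ρ vB ∧ ρ vL = ρ vN ∧ ρ vR = 1 ∧ ρ vK = ρ vN) ∨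
    (ρ vM ≠ 0 ∧ ρ vS = 6 ∧ ρ vB = 3 * ρ vN + 1 ∧ ρ vK = ρ vL * ρ vD)
  codes : ρ vP = ρ vB ^ ρ vL

theorem Params.base_pos {ρ : ℕ → ℕ} (h : Params ρ) : 0 < ρ vB := by
  rcases h.mode with h | h <;> omega

open Classical in
/-- The colouring after `r` rounds; the colour `0` stands for an uncoloured vertex. -/
structure PartialColoring (E : ℕ → ℕ → Prop) (ρ : ℕ → ℕ) (r : ℕ) (C : ℕ → ℕ) : Prop where
  le : ∀ w < ρ vN, C w ≤ ρ vS * r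
  proper : ∀ u < ρ vN, ∀ v < ρ vN, E u v → C u ≠ 0 → C u ≠ C v
  progress : r * ρ vK ≤ #{w ∈ range (ρ vN) | C w ≠ 0} ∨
    ∀ v < ρ vN, #{w ∈ range (ρ vN) | E v w ∧ C w = 0} < ρ vD

/-- New colours exceed all old ones and go to uncoloured vertices, so properness has to be checked
among them only. For the same reason the counts of coloured vertices add up. Sparsity of the
uncoloured part persists as more vertices are coloured. -/
theorem PartialColoring.accept {ρ : ℕ → ℕ} {r : ℕ} {σ : Store}
    (h : PartialColoring (σ.Edge (ρ vN)) ρ r (σ.arr aCol))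
    (hs : ∀ w < ρ vN, σ.arr aNew w ≠ 0 → σ.arr aCol w = 0 ∧
      ρ vS * r < σ.arr aNew w ∧ σ.arr aNew w ≤ ρ vS * r + ρ vS)
    (hn : σ.NewProper (ρ vN)) (hp : σ.Progress (ρ vN) (ρ vD) (ρ vK)) :
    PartialColoring (σ.Edge (ρ vN)) ρ (r + 1) ((Prog.accept.eval ρ σ).arr aCol) := by
  classical
  have acc := (Prog.eval_accept ρ σ).1
  have zero : ∀ w < ρ vN, (Prog.accept.eval ρ σ).arr aCol w = 0 ↔
      σ.arr aCol w = 0 ∧ σ.arr aNew w = 0 := by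
    intro w hw
    rw [acc w hw]
    split_ifs <;> simp_all
  refine ⟨fun w hw => ?_, fun u hu v hv huv hu0 => ?_, ?_⟩
  · rw [acc w hw, mul_add, mul_one]
    have := h.le w hw
    split_ifs with e
    · exact (hs w hw e).2.2
    · omega
  · rw [acc u hu, acc v hv]
    rw [acc u hu] at hu0
    have lu := h.le u hu
    have lv := h.le v hv
    split_ifs at hu0 ⊢ with eu ev ev
    · exact hn u hu v hv huv eu
    · have := hs u hu eu; omega
    · have := hs v hv ev; omega
    · exact h.proper u hu v hv huv hu0
  · have sparse (h : ∀ v < ρ vN, #{w ∈ range (ρ vN) | σ.Edge (ρ vN) v w ∧ σ.arr aCol w = 0 ∧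
          σ.arr aNew w = 0} < ρ vD) : ∀ v < ρ vN, #{w ∈ range (ρ vN) | σ.Edge (ρ vN) v w ∧
          (Prog.accept.eval ρ σ).arr aCol w = 0} < ρ vD := by
      intro v hv
      refine (card_le_card fun w => ?_).trans_lt (h v hv)
      simp only [mem_filter, mem_range]
      rintro ⟨a, b, c⟩
      exact ⟨a, b, (zero w a).1 c⟩
    rcases h.progress with h1 | h1
    · rcases hp with h2 | h2
      · left
        rw [add_mul, one_mul]
        refine (Nat.add_le_add h1 h2).trans ?_
        rw [← card_union_of_disjoint]
        · refine card_le_card fun w => ?_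
          simp only [mem_union, mem_filter, mem_range]
          rintro (⟨a, b⟩ | ⟨a, b⟩) <;> refine ⟨a, fun c => b ?_⟩
          exacts [((zero w a).1 c).1, ((zero w a).1 c).2]
        · rw [disjoint_left]
          intro w
          simp only [mem_filter, mem_range]
          rintro ⟨a, b⟩ ⟨-, c⟩
          exact b (hs w a c).1
      · exact .inr (sparse h2)
    · refine .inr (sparse fun v hv => (card_le_card fun w => ?_).trans_lt (h1 v hv))
      simp only [mem_filter]
      tauto

theorem Prog.eval_digits {ρ : ℕ → ℕ} (σ : Store) (hB : 0 < ρ vB) (hP : ρ vCode ≤ ρ vP) :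
    ∀ i < ρ vL, (decode.eval ρ (σ.setArr aTmp 0 (ρ vCode))).arr aDig i =
      ρ vCode / ρ vB ^ i % ρ vB := by
  have h := Prog.eval_decode ρ (σ.setArr aTmp 0 (ρ vCode)) hB
  simp only [Store.setArr_arr, if_true, Function.update_self] at h
  exact h hP

theorem Prog.eval_candidate (ρ : ℕ → ℕ) (σ : Store) :
    candidate.eval ρ σ = if ρ vM ≠ 0 then
      extend.eval ρ (decode.eval ρ (σ.setArr aTmp 0 (ρ vCode))) else
      direct.eval ρ (decode.eval ρ (σ.setArr aTmp 0 (ρ vCode))) := rfl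

theorem Prog.decode_setArr (ρ : ℕ → ℕ) (σ : Store) (x : ℕ) :
    (decode.eval ρ (σ.setArr aTmp 0 x)).Edge = σ.Edge ∧
    (decode.eval ρ (σ.setArr aTmp 0 x)).arr aCol = σ.arr aCol :=
  ⟨(Prog.eval_edge_of_silent (by simp [Prog.Silent, decode]) _ _).trans rfl,
    (Prog.eval_arr _ _ _ (by decide)).trans (by simp [Store.setArr_arr])⟩

theorem Prog.silent_extend : Prog.Silent extend := by
  simp [Prog.Silent, extend, classify, bipartition, addEdge, merge]

theorem Prog.silent_candidate : Prog.Silent candidate := by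
  refine ⟨trivial, ?_, silent_extend, ?_⟩ <;> simp [Prog.Silent, decode, direct]

/-- This is true for every code, right or wrong. In the exhaustive search there is only round 0, in
which no vertex is coloured yet. -/
theorem Prog.candidate_sound {ρ : ℕ → ℕ} {r : ℕ} {σ : Store} (hρ : Params ρ)
    (h : PartialColoring (σ.Edge (ρ vN)) ρ r (σ.arr aCol)) (hr : r < ρ vR)
    (hO : ρ vO = ρ vS * r) (hc : ρ vCode < ρ vP) : ∀ w < ρ vN,
    (candidate.eval ρ σ).arr aNew w ≠ 0 → σ.arr aCol w = 0 ∧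
      ρ vS * r < (candidate.eval ρ σ).arr aNew w ∧
      (candidate.eval ρ σ).arr aNew w ≤ ρ vS * r + ρ vS := by
  intro w hw h0
  have dig := Prog.eval_digits σ hρ.base_pos hc.le
  have dc := (Prog.decode_setArr ρ σ (ρ vCode)).2
  rw [Prog.eval_candidate] at *
  rcases hρ.mode with ⟨h1, h2, h3, h4, h5, h6⟩ | ⟨h1, h2, h3, h4⟩
  · rw [if_neg (by simpa using h1)] at *
    obtain rfl : r = 0 := by omega
    have := h.le w hw
    rw [Prog.eval_direct _ _ w hw, dig w (by omega), hO, ← h2]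
    have := Nat.mod_lt (ρ vCode / ρ vB ^ w) hρ.base_pos
    omega
  · rw [if_pos h1] at *
    have := (Prog.eval_extend ρ (decode.eval ρ (σ.setArr aTmp 0 (ρ vCode)))).1 w hw h0
    rw [dc, hO] at this
    rw [h2] at this ⊢
    exact this

/-- In the exhaustive search the code of `f` itself is good, otherwise the code of the digits from
`exists_digits`. It has to serve all stores with the same edges and colours, because earlier
attempts leave the other arrays in an unknown state. -/
theorem exists_good_code {ρ : ℕ → ℕ} (hρ : Params ρ) (σ : Store) (f : ℕ → ℕ)
    (hf : ∀ u < ρ vN, f u < 3)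
    (hE : ∀ u < ρ vN, ∀ v < ρ vN, σ.Edge (ρ vN) u v → f u ≠ f v) :
    ∃ a < ρ vP, ∀ σ' : Store, σ'.Edge = σ.Edge → σ'.arr aCol = σ.arr aCol →
      (Prog.candidate.eval (Function.update ρ vCode a) σ').NewProper (ρ vN) ∧
      (Prog.candidate.eval (Function.update ρ vCode a) σ').Progress (ρ vN) (ρ vD) (ρ vK) := by
  classical
  rcases hρ.mode with ⟨h1, h2, h3, h4, h5, h6⟩ | ⟨h1, h2, h3, h4⟩
  · obtain ⟨a, ha, hX⟩ := exists_code (B := ρ vB) (L := ρ vL) f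
      fun i hi => (hf i (by omega)).trans_le h3
    refine ⟨a, by rwa [hρ.codes], fun σ' e1 e2 => ?_⟩
    set ρ' := Function.update ρ vCode a with hρ'
    have dig : ∀ i < ρ vL, (Prog.decode.eval ρ' (σ'.setArr aTmp 0 a)).arr aDig i = f i := by
      intro i hi
      rw [← hX i hi]
      have := Prog.eval_digits (ρ := ρ') σ' (by simpa [hρ'] using hρ.base_pos)
        (by simpa [hρ', hρ.codes] using ha.le) i (by simpa [hρ'] using hi)
      simpa [hρ'] using this
    have edge := (Prog.eval_edge_of_silent Prog.silent_candidate ρ' σ').trans e1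
    have new : ∀ w < ρ vN, (Prog.candidate.eval ρ' σ').arr aNew w = ρ vO + (f w + 1) := by
      intro w hw
      rw [Prog.eval_candidate, if_neg (by simpa [hρ'] using h1),
        Prog.eval_direct _ _ w (by simpa [hρ'] using hw)]
      rw [show ρ' vCode = a by simp [hρ'], dig w (by omega)]
      simp [hρ']
    refine ⟨fun u hu v hv huv _ => ?_, .inl ?_⟩
    · rw [edge] at huv
      rw [new u hu, new v hv]
      have := hE u hu v hv huv
      omega
    · rw [h6, filter_true_of_mem, card_range]
      intro w hw
      rw [new w (mem_range.1 hw)]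
      omega
  · obtain ⟨X, x1, x2, x3⟩ := exists_digits (n := ρ vN) (d := ρ vD) (σ.Edge (ρ vN))
      (fun w => σ.arr aCol w = 0) f hf (ρ vL)
    obtain ⟨a, ha, hX⟩ := exists_code (B := ρ vB) (L := ρ vL) X
      fun i hi => by have := x1 i; omega
    refine ⟨a, by rwa [hρ.codes], fun σ' e1 e2 => ?_⟩
    set ρ' := Function.update ρ vCode a with hρ'
    have dig : ∀ i < ρ vL, (Prog.decode.eval ρ' (σ'.setArr aTmp 0 a)).arr aDig i = X i := by
      intro i hi
      rw [← hX i hi]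
      have := Prog.eval_digits (ρ := ρ') σ' (by simpa [hρ'] using hρ.base_pos)
        (by simpa [hρ', hρ.codes] using ha.le) i (by simpa [hρ'] using hi)
      simpa [hρ'] using this
    have edge := (Prog.eval_edge_of_silent Prog.silent_candidate ρ' σ').trans e1
    have col : (Prog.candidate.eval ρ' σ').arr aCol = σ.arr aCol :=
      (Prog.eval_arr _ _ _ (by decide)).trans e2
    set σ₂ := Prog.decode.eval ρ' (σ'.setArr aTmp 0 a) with hσ₂
    have edge₂ : σ₂.Edge = σ.Edge := (Prog.decode_setArr ρ' σ' a).1.trans e1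
    have col₂ : σ₂.arr aCol = σ.arr aCol := (Prog.decode_setArr ρ' σ' a).2.trans e2
    have near : ∀ c w, σ₂.Near (ρ vN) (ρ vL) c w ↔
        ∃ i < ρ vL, ∃ u < ρ vN, X i = ρ vN * c + u ∧ σ.Edge (ρ vN) u w := by
      intro c w
      refine exists_congr fun i => and_congr_right fun hi => ?_
      rw [dig i hi, edge₂]
    have ev : Prog.candidate.eval ρ' σ' = Prog.extend.eval ρ' σ₂ := by
      rw [Prog.eval_candidate, if_pos (by simpa [hρ'] using h1),
        show ρ' vCode = a by simp [hρ']]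
    obtain ⟨-, p2, p3⟩ := Prog.eval_extend ρ' σ₂
    rw [show ρ' vN = ρ vN by simp [hρ'], show ρ' vL = ρ vL by simp [hρ'], ← ev] at p2 p3
    simp only [near, col₂] at p2
    refine ⟨p3 f hf (by rwa [edge₂]) fun i hi c hc u hu h => ?_, ?_⟩
    · rw [dig i hi] at h
      exact x2 i hi c hc u hu h
    · unfold Store.Progress
      rw [h4, edge, col]
      rcases x3 with h | h
      · refine .inl (h.trans (card_le_card fun w => ?_))
        simp only [mem_filter]
        rintro ⟨a, b⟩
        exact ⟨a, (p2 w (mem_range.1 a)).2 b⟩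
      · refine .inr fun v hv => (card_le_card fun w => ?_).trans_lt (h v hv)
        simp only [mem_filter]
        rintro ⟨a, b, c, d⟩
        exact ⟨a, b, c, fun e => (p2 w (mem_range.1 a)).2 ⟨c, e⟩ d⟩

theorem Prog.eval_attempt (ρ : ℕ → ℕ) (σ : Store) :
    (σ.arr aFound 0 = 0 ∧ (candidate.eval ρ σ).NewProper (ρ vN) ∧
      (candidate.eval ρ σ).Progress (ρ vN) (ρ vD) (ρ vK) →
      attempt.eval ρ σ = accept.eval ρ (candidate.eval ρ σ)) ∧
    (¬ (σ.arr aFound 0 = 0 ∧ (candidate.eval ρ σ).NewProper (ρ vN) ∧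
      (candidate.eval ρ σ).Progress (ρ vN) (ρ vD) (ρ vK)) →
      attempt.eval ρ σ = candidate.eval ρ σ) := by
  have key : (Expr.and (.not (.get aFound (.cst 0)))
      (.and .newProper (.or .newMany .restSparse))).eval (candidate.eval ρ σ) ρ ≠ 0 ↔
      σ.arr aFound 0 = 0 ∧ (candidate.eval ρ σ).NewProper (ρ vN) ∧
        (candidate.eval ρ σ).Progress (ρ vN) (ρ vD) (ρ vK) := by
    rw [Expr.eval_and, boole_ne_zero, Expr.eval_and, boole_ne_zero, Expr.eval_not, boole_ne_zero,
      Expr.eval_newProper, Expr.eval_progress]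
    rw [← Prog.eval_arr candidate ρ σ (k := aFound) (by decide)]
    rfl
  rw [← key]
  constructor <;> intro h
  · change (if _ then _ else _) = _
    rw [if_pos h]
  · change (if _ then _ else _) = _
    rw [if_neg h]; rfl

theorem Prog.silent_attempt : Prog.Silent attempt :=
  ⟨silent_candidate, by simp [Prog.Silent, accept], trivial⟩

theorem Params.update {ρ : ℕ → ℕ} (h : Params ρ) {i : ℕ} (hi : vP < i) (x : ℕ) :
    Params (Function.update ρ i x) := by
  have e : ∀ j ≤ vP, Function.update ρ i x j = ρ j := fun j hj =>
    Function.update_of_ne (by omega) _ _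
  constructor
  · simpa [e] using h.mode
  · simpa [e] using h.codes

theorem PartialColoring.update {E : ℕ → ℕ → Prop} {ρ : ℕ → ℕ} {r : ℕ} {C : ℕ → ℕ} {i : ℕ}
    (hi : vP < i) (x : ℕ) :
    PartialColoring E (Function.update ρ i x) r C ↔ PartialColoring E ρ r C := by
  have e : ∀ j ≤ vP, Function.update ρ i x j = ρ j := fun j hj =>
    Function.update_of_ne (by omega) _ _
  constructor <;> intro h <;> constructor
  · simpa [e] using h.le
  · simpa [e] using h.proper
  · simpa [e] using h.progress
  · simpa [e] using h.le
  · simpa [e] using h.proper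
  · simpa [e] using h.progress

theorem Prog.eval_round {ρ : ℕ → ℕ} (hρ : Params ρ) (σ : Store) (f : ℕ → ℕ)
    (hf : ∀ u < ρ vN, f u < 3)
    (hE : ∀ u < ρ vN, ∀ v < ρ vN, σ.Edge (ρ vN) u v → f u ≠ f v) (hr : ρ vRound < ρ vR)
    (h : PartialColoring (σ.Edge (ρ vN)) ρ (ρ vRound) (σ.arr aCol)) :
    PartialColoring (σ.Edge (ρ vN)) ρ (ρ vRound + 1) ((round.eval ρ σ).arr aCol) := by
  set ρ' := Function.update ρ vO (ρ vS * ρ vRound) with hρ'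
  have hρ'' : Params ρ' := hρ.update (by decide) _
  have hvar : ∀ i, i ≠ vO → ρ' i = ρ i := fun i hi => Function.update_of_ne hi _ _
  have hv0 : ρ' vO = ρ vS * ρ vRound := by simp [hρ']
  have ev : round.eval ρ σ = (Prog.loop vP vCode attempt).eval ρ' (σ.setArr aFound 0 0) := by
    simp [round, Prog.eval, Expr.eval, hρ']
  obtain ⟨a, ha, good⟩ := exists_good_code hρ'' σ f (by simpa [hvar] using hf)
    (by simpa [hvar] using hE)
  -- Before attempt j, either nothing has been accepted and j has not passed the good code `a`, or
  -- an extension has been accepted. After the last attempt the first case contradicts `ha`.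
  have key := iter_induction (N := ρ' vP) (σ := σ.setArr aFound 0 0)
    (f := fun j => attempt.eval (Function.update ρ' vCode j))
    (fun j σ' => σ'.Edge = σ.Edge ∧
      ((σ'.arr aFound 0 = 0 ∧ σ'.arr aCol = σ.arr aCol ∧ j ≤ a) ∨ (σ'.arr aFound 0 ≠ 0 ∧
        PartialColoring (σ.Edge (ρ vN)) ρ (ρ vRound + 1) (σ'.arr aCol))))
    ⟨rfl, .inl (by simp [Store.setArr_arr])⟩ (by
      rintro j hj σ' ⟨e, inv⟩
      set ρj := Function.update ρ' vCode j with hρj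
      have hvar' : ∀ i, i ≠ vO → i ≠ vCode → ρj i = ρ i := fun i hi hi' => by
        rw [hρj, Function.update_of_ne hi', hvar i hi]
      refine ⟨(Prog.eval_edge_of_silent silent_attempt _ _).trans e, ?_⟩
      have c1 : (candidate.eval ρj σ').arr aFound = σ'.arr aFound :=
        Prog.eval_arr _ _ _ (by decide)
      have c2 : (candidate.eval ρj σ').arr aCol = σ'.arr aCol :=
        Prog.eval_arr _ _ _ (by decide)
      have c3 : (candidate.eval ρj σ').Edge = σ.Edge :=
        (Prog.eval_edge_of_silent silent_candidate _ _).trans e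
      by_cases t : σ'.arr aFound 0 = 0 ∧ (candidate.eval ρj σ').NewProper (ρj vN) ∧
        (candidate.eval ρj σ').Progress (ρj vN) (ρj vD) (ρj vK)
      · right
        obtain ⟨-, col, -⟩ := inv.resolve_right fun h => h.1 t.1
        simp only [(Prog.eval_attempt ρj σ').1 t]
        refine ⟨by simp [(Prog.eval_accept ρj _).2], ?_⟩
        have hC : PartialColoring (σ'.Edge (ρj vN)) ρj (ρ vRound) (σ'.arr aCol) := by
          rw [col, e, hρj, PartialColoring.update (by decide), hρ',
            PartialColoring.update (by decide)]
          simpa using h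
        have hsound := Prog.candidate_sound (hρ''.update (by decide) j) hC
          (by simpa [hvar] using hr) (by simp [hvar, hv0]) (by simpa [hρj] using hj)
        have := PartialColoring.accept (σ := candidate.eval ρj σ') (r := ρ vRound)
          (by rw [c2, c3, ← e]; exact hC) (by rw [c2]; exact hsound) t.2.1 t.2.2
        rw [c3, hρj, PartialColoring.update (by decide), hρ',
          PartialColoring.update (by decide)] at this
        simpa using this
      · simp only [(Prog.eval_attempt ρj σ').2 t, c1, c2]
        refine inv.imp_left fun ⟨h1, h2, h3⟩ => ⟨h1, h2, Nat.succ_le_of_lt ?_⟩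
        -- The attempt with the good code cannot have been rejected.
        refine lt_of_le_of_ne h3 ?_
        rintro rfl
        refine t ⟨h1, ?_⟩
        have := good σ' e h2
        simpa [hvar', hvar, hρj] using this)
  have e : (round.eval ρ σ) = iter (fun j => attempt.eval (Function.update ρ' vCode j)) (ρ' vP)
      (σ.setArr aFound 0 0) := ev
  rw [← e] at key
  rcases key.2 with h | h
  · omega
  · exact h.2

theorem Prog.eval_rounds {ρ : ℕ → ℕ} (hρ : Params ρ) (σ : Store) (f : ℕ → ℕ)
    (hf : ∀ u < ρ vN, f u < 3)
    (hE : ∀ u < ρ vN, ∀ v < ρ vN, σ.Edge (ρ vN) u v → f u ≠ f v) (h0 : σ.arr aCol = fun _ => 0) :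
    PartialColoring (σ.Edge (ρ vN)) ρ (ρ vR)
      (((Prog.loop vR vRound round).eval ρ σ).arr aCol) := by
  refine (iter_induction (N := ρ vR) (σ := σ)
    (fun r σ' => σ'.Edge = σ.Edge ∧ PartialColoring (σ.Edge (ρ vN)) ρ r (σ'.arr aCol))
    ⟨rfl, ?_⟩ ?_).2
  · rw [h0]
    exact ⟨by simp, by simp, .inl (by simp)⟩
  · rintro r hr σ' ⟨e, h⟩
    refine ⟨(Prog.eval_edge_of_silent (c := round) ⟨trivial, silent_attempt⟩ _ _).trans e, ?_⟩
    have := Prog.eval_round (ρ := Function.update ρ vRound r) (hρ.update (by decide) r) σ' f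
      (by simpa using hf) (by simpa [e] using hE) (by simpa using hr)
      (by rw [PartialColoring.update (by decide), e]; simpa using h)
    rw [PartialColoring.update (by decide), e] at this
    simpa using this

/-! ### The greedy phase and the output -/

/-- All `vD` colours are tried, and each free one overwrites the previous choice. This is harmless
because the vertex is not its own neighbour. The colour stays 0 only if every colour is blocked. -/
theorem Prog.eval_greedy_vertex (ρ : ℕ → ℕ) (σ : Store) (hirr : ¬ σ.Edge (ρ vN) (ρ vV) (ρ vV))
    (h0 : σ.arr aCol (ρ vV) = 0) : ∃ x, ((Prog.loop vD vY <|
      .ite (.sum vN vW (.and (.edge vV vW)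
          (.eq (.cell aCol vW) (.add (.var vO) (.add (.var vY) (.cst 1))))))
        .skip (.store aCol (.var vV) (.add (.var vO) (.add (.var vY) (.cst 1))))).eval ρ σ).arr aCol
      = Function.update (σ.arr aCol) (ρ vV) x ∧
    ((x = 0 ∧ ∀ y < ρ vD, ∃ w < ρ vN, σ.Edge (ρ vN) (ρ vV) w ∧ σ.arr aCol w = ρ vO + (y + 1)) ∨
      ∃ y < ρ vD, x = ρ vO + (y + 1) ∧
        ∀ w < ρ vN, σ.Edge (ρ vN) (ρ vV) w → σ.arr aCol w ≠ x) := by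
  refine (iter_induction (N := ρ vD) (σ := σ) (fun j σ' => σ'.Edge = σ.Edge ∧ ∃ x,
    σ'.arr aCol = Function.update (σ.arr aCol) (ρ vV) x ∧
    ((x = 0 ∧ ∀ y < j, ∃ w < ρ vN, σ.Edge (ρ vN) (ρ vV) w ∧ σ.arr aCol w = ρ vO + (y + 1)) ∨
      ∃ y < j, x = ρ vO + (y + 1) ∧
        ∀ w < ρ vN, σ.Edge (ρ vN) (ρ vV) w → σ.arr aCol w ≠ x))
    ⟨rfl, 0, by rw [← h0, Function.update_eq_self], .inl (by simp)⟩ ?_).2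
  rintro j hj σ' ⟨e, x, hx, inv⟩
  have key : (Expr.sum vN vW (.and (.edge vV vW)
      (.eq (.cell aCol vW) (.add (.var vO) (.add (.var vY) (.cst 1)))))).eval σ'
      (Function.update ρ vY j) ≠ 0 ↔
      ∃ w < ρ vN, σ.Edge (ρ vN) (ρ vV) w ∧ σ.arr aCol w = ρ vO + (j + 1) := by
    rw [Expr.eval, ne_eq, sum_eq_zero_iff]
    push Not
    simp only [mem_range]
    refine exists_congr fun w => and_congr_right fun _ => ?_
    rw [Expr.eval_and, boole_ne_zero, Expr.eval_edge _ _ (by decide), Expr.eval_eq, boole_ne_zero]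
    have hne : σ.Edge (ρ vN) (ρ vV) w → w ≠ ρ vV := by rintro h rfl; exact hirr h
    rw [← e] at hne ⊢
    simp only [Store.Edge, Expr.cell, Expr.eval, hx] at hne ⊢
    simp at hne ⊢
    intro he
    rw [Function.update_of_ne (hne he)]
  by_cases t : ∃ w < ρ vN, σ.Edge (ρ vN) (ρ vV) w ∧ σ.arr aCol w = ρ vO + (j + 1)
  · have ev (c : Prog) : (Prog.ite (.sum vN vW (.and (.edge vV vW)
      (.eq (.cell aCol vW) (.add (.var vO) (.add (.var vY) (.cst 1)))))) .skip c).eval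
      (Function.update ρ vY j) σ' = σ' := if_pos (key.2 t)
    simp only [ev]
    refine ⟨e, x, hx, inv.imp (fun ⟨h, h'⟩ => ⟨h, fun y hy => ?_⟩)
      fun ⟨y, hy, h⟩ => ⟨y, by omega, h⟩⟩
    rcases Nat.lt_succ_iff_lt_or_eq.1 hy with hy | rfl
    exacts [h' y hy, t]
  · have ev (c : Prog) : (Prog.ite (.sum vN vW (.and (.edge vV vW)
      (.eq (.cell aCol vW) (.add (.var vO) (.add (.var vY) (.cst 1)))))) .skip c).eval
      (Function.update ρ vY j) σ' = c.eval (Function.update ρ vY j) σ' :=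
      if_neg (mt key.1 t)
    simp only [ev]
    refine ⟨e, ρ vO + (j + 1), ?_, .inr ⟨j, by omega, rfl, fun w hw hE h => t ⟨w, hw, hE, h⟩⟩⟩
    simp [Prog.eval, Expr.eval, Store.setArr_arr, hx]

/-- A colour above `vO` can be blocked only by a neighbour that was uncoloured at the start. If all
`vD` colours were blocked, there would be `vD` such neighbours, against `hsp`. -/
theorem Prog.eval_greedy (ρ : ℕ → ℕ) (σ : Store)
    (hirr : ∀ u < ρ vN, ¬ σ.Edge (ρ vN) u u)
    (hsymm : ∀ u < ρ vN, ∀ v < ρ vN, σ.Edge (ρ vN) u v → σ.Edge (ρ vN) v u)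
    (hle : ∀ w < ρ vN, σ.arr aCol w ≤ ρ vO)
    (hprop : ∀ u < ρ vN, ∀ v < ρ vN, σ.Edge (ρ vN) u v → σ.arr aCol u ≠ 0 →
      σ.arr aCol u ≠ σ.arr aCol v)
    (hsp : ∀ v < ρ vN, σ.arr aCol v = 0 → ∀ s : Finset ℕ,
      (∀ w ∈ s, w < ρ vN ∧ σ.Edge (ρ vN) v w ∧ σ.arr aCol w = 0) → #s < ρ vD) :
    (∀ w < ρ vN, (greedy.eval ρ σ).arr aCol w ≠ 0 ∧
      (greedy.eval ρ σ).arr aCol w ≤ ρ vO + ρ vD) ∧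
    ∀ u < ρ vN, ∀ v < ρ vN, σ.Edge (ρ vN) u v →
      (greedy.eval ρ σ).arr aCol u ≠ (greedy.eval ρ σ).arr aCol v := by
  have key := iter_induction (N := ρ vN) (σ := σ) (f := fun j => (Prog.ite (.cell aCol vV) .skip <|
      .loop vD vY <| .ite (.sum vN vW (.and (.edge vV vW)
          (.eq (.cell aCol vW) (.add (.var vO) (.add (.var vY) (.cst 1))))))
        .skip (.store aCol (.var vV) (.add (.var vO) (.add (.var vY) (.cst 1))))).eval
      (Function.update ρ vV j))
    (fun j σ' => σ'.Edge = σ.Edge ∧ (∀ w < ρ vN, σ.arr aCol w ≠ 0 → σ'.arr aCol w = σ.arr aCol w) ∧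
      (∀ w < j, σ'.arr aCol w ≠ 0) ∧ (∀ w < ρ vN, σ'.arr aCol w ≤ ρ vO + ρ vD) ∧
      ∀ u < ρ vN, ∀ v < ρ vN, σ.Edge (ρ vN) u v → σ'.arr aCol u ≠ 0 →
        σ'.arr aCol u ≠ σ'.arr aCol v)
    ⟨rfl, by simp, by simp, fun w hw => by have := hle w hw; omega, hprop⟩ (by
      rintro j hj σ' ⟨h1, h2, h3, h4, h5⟩
      by_cases h0 : σ'.arr aCol j = 0
      · have ev (c d : Prog) : (Prog.ite (.cell aCol vV) c d).eval (Function.update ρ vV j) σ' =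
            d.eval (Function.update ρ vV j) σ' := if_neg (by simpa [Expr.cell, Expr.eval] using h0)
        simp only [ev]
        obtain ⟨x, hx, hx'⟩ := Prog.eval_greedy_vertex (Function.update ρ vV j) σ'
          (by simpa [h1] using hirr j hj) (by simpa using h0)
        rw [h1] at hx'
        simp at hx hx'
        have hcol : σ.arr aCol j = 0 := by
          by_contra h
          exact h (h2 j hj h ▸ h0)
        have hx'' := hx'.resolve_left (by
          rintro ⟨-, hy⟩
          choose! g hg using hy
          have inj : Set.InjOn g (range (ρ vD)) := by
            intro a ha b hb hab
            have e1 := (hg a (mem_range.1 ha)).2.2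
            have e2 := (hg b (mem_range.1 hb)).2.2
            rw [hab] at e1
            omega
          have := hsp j hj hcol ((range (ρ vD)).image g) (by
            intro w hw
            obtain ⟨y, hy, rfl⟩ := mem_image.1 hw
            obtain ⟨g1, g2, g3⟩ := hg y (mem_range.1 hy)
            refine ⟨g1, g2, ?_⟩
            by_contra hne
            have := h2 _ g1 hne
            have := hle _ g1
            omega)
          rw [card_image_of_injOn inj, card_range] at this
          exact this.false)
        obtain ⟨y, hy, hxy, hun⟩ := hx''
        rw [hx]
        refine ⟨(Prog.eval_edge_of_silent (by simp [Prog.Silent]) _ _).trans h1,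
          fun w hw hne => ?_, fun w hw => ?_, fun w hw => ?_, fun u hu v hv huv hu0 => ?_⟩
        · rw [Function.update_of_ne (by rintro rfl; exact hne hcol), h2 w hw hne]
        · by_cases e : w = j
          · simp [e]; omega
          · rw [Function.update_of_ne e]; exact h3 w (by omega)
        · by_cases e : w = j
          · simp [e]; omega
          · rw [Function.update_of_ne e]; exact h4 w hw
        · by_cases eu : u = j <;> by_cases ev : v = j
          · rw [eu, ev] at huv; exact (hirr j hj huv).elim
          · rw [eu, Function.update_self, Function.update_of_ne ev]
            rw [eu] at huv
            exact fun h => hun v hv huv h.symm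
          · rw [ev, Function.update_self, Function.update_of_ne eu]
            rw [ev] at huv
            exact hun u hu (hsymm u hu j hj huv)
          · rw [Function.update_of_ne eu] at hu0 ⊢
            rw [Function.update_of_ne ev]
            exact h5 u hu v hv huv hu0
      · have ev (c : Prog) : (Prog.ite (.cell aCol vV) .skip c).eval (Function.update ρ vV j) σ' =
            σ' := if_pos (by simpa [Expr.cell, Expr.eval] using h0)
        simp only [ev]
        refine ⟨h1, h2, fun w hw => ?_, h4, h5⟩
        rcases Nat.lt_succ_iff_lt_or_eq.1 hw with hw | rfl
        exacts [h3 w hw, h0])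
  obtain ⟨-, -, h3, h4, h5⟩ := key
  exact ⟨fun w hw => ⟨h3 w hw, h4 w hw⟩, fun u hu v hv huv => h5 u hu v hv huv (h3 u hu)⟩

theorem Prog.eval_output (ρ : ℕ → ℕ) (σ : Store) (hb : ρ vN * ρ vN + ρ vN ≤ σ.b) :
    ∀ v < ρ vN, (output.eval ρ σ).low (ρ vN * ρ vN + v) = σ.arr aCol v - 1 := by
  refine (iter_induction (N := ρ vN) (σ := σ) (fun j σ' => σ'.b = σ.b ∧
    σ'.arr aCol = σ.arr aCol ∧ ∀ v < j, σ'.low (ρ vN * ρ vN + v) = σ.arr aCol v - 1)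
    ⟨rfl, rfl, by simp⟩ ?_).2.2
  rintro j hj σ' ⟨h1, h2, h3⟩
  refine ⟨h1, h2, fun v hv => ?_⟩
  have e : min (ρ vN * ρ vN + j) σ'.b = ρ vN * ρ vN + j := by omega
  simp [Prog.eval, Expr.eval, Expr.cell, Store.setLow, e, h2, Function.update_apply]
  split_ifs with h
  · rw [h]
  · exact h3 v (by omega)

/-- The main program finds a proper colouring. -/
theorem Prog.eval_main {ρ : ℕ → ℕ} (hρ : Params ρ) (σ : Store) (f : ℕ → ℕ)
    (hb : ρ vN * ρ vN + ρ vN ≤ σ.b) (hK : ρ vN ≤ ρ vR * ρ vK)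
    (hf : ∀ u < ρ vN, f u < 3)
    (hE : ∀ u < ρ vN, ∀ v < ρ vN, σ.Edge (ρ vN) u v → f u ≠ f v)
    (hsymm : ∀ u < ρ vN, ∀ v < ρ vN, σ.Edge (ρ vN) u v → σ.Edge (ρ vN) v u)
    (h0 : σ.arr aCol = fun _ => 0) :
    (∀ v < ρ vN, (main.eval ρ σ).low (ρ vN * ρ vN + v) < ρ vR * ρ vS + ρ vD) ∧
    ∀ u < ρ vN, ∀ v < ρ vN, σ.Edge (ρ vN) u v →
      (main.eval ρ σ).low (ρ vN * ρ vN + u) ≠ (main.eval ρ σ).low (ρ vN * ρ vN + v) := by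
  classical
  have part := Prog.eval_rounds hρ σ f hf hE h0
  set σ₁ := (Prog.loop vR vRound round).eval ρ σ with hσ₁
  have edge : σ₁.Edge = σ.Edge :=
    Prog.eval_edge_of_silent (c := .loop vR vRound round) ⟨trivial, silent_attempt⟩ _ _
  set ρ' := Function.update ρ vO (ρ vR * ρ vS) with hρ'
  have hvar : ∀ i, i ≠ vO → ρ' i = ρ i := fun i hi => Function.update_of_ne hi _ _
  have hv0 : ρ' vO = ρ vR * ρ vS := by simp [hρ']
  set σ₂ := greedy.eval ρ' σ₁ with hσ₂
  have ev : main.eval ρ σ = output.eval ρ σ₂ := by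
    simp [main, Prog.eval, Expr.eval, hσ₂, hρ', hσ₁]
  obtain ⟨g1, g2⟩ := Prog.eval_greedy ρ' σ₁
    (by rw [edge, hvar _ (by decide)]; exact fun u hu h => hE u hu u hu h rfl)
    (by rwa [edge, hvar _ (by decide)])
    (by rw [hv0, hvar _ (by decide), mul_comm]; exact part.le)
    (by rw [edge, hvar _ (by decide)]; exact part.proper)
    (by
      rw [edge, hvar _ (by decide), hvar _ (by decide)]
      intro v hv hv0 s hs
      -- In the first case at least R * K ≥ n vertices are coloured, which leaves no room for `v`.
      rcases part.progress with h | h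
      · exfalso
        have : #{w ∈ range (ρ vN) | σ₁.arr aCol w ≠ 0} < #(range (ρ vN)) :=
          card_lt_card (filter_ssubset.2 ⟨v, mem_range.2 hv, by simpa using hv0⟩)
        rw [card_range] at this
        omega
      · refine (card_le_card fun w hw => ?_).trans_lt (h v hv)
        rw [mem_filter, mem_range]
        exact hs w hw)
  rw [hvar _ (by decide), ← hσ₂] at g1 g2
  rw [hv0, hvar _ (by decide)] at g1
  rw [edge] at g2
  have out := Prog.eval_output ρ σ₂ (by rw [hσ₂, hσ₁, Prog.eval_b, Prog.eval_b]; exact hb)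
  rw [ev]
  refine ⟨fun v hv => ?_, fun u hu v hv huv => ?_⟩
  · have := g1 v hv
    rw [out v hv]
    omega
  · have := g1 u hu
    have := g1 v hv
    have := g2 u hu v hv huv
    rw [out u hu, out v hv]
    omega

/-! ### The parameters -/

/-- Running `c` amounts to running `c'`, up to a bounded number of steps. -/
structure Reduces (M : ℕ) (c : Prog) (ρ : ℕ → ℕ) (σ : Store)
    (c' : Prog) (ρ' : ℕ → ℕ) (σ' : Store) : Prop where
  eval : c.eval ρ σ = c'.eval ρ' σ'
  cost_ge : c'.cost ρ' σ' ≤ c.cost ρ σ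
  cost_le : c'.cost ρ' σ' ≤ c'.bound M → c.cost ρ σ ≤ c.bound M

theorem Reduces.let_step {M : ℕ} {i : ℕ} {e : Expr} {c : Prog} {ρ : ℕ → ℕ} {σ : Store} {x : ℕ}
    {c' : Prog} {ρ' : ℕ → ℕ} {σ' : Store} (V : List ℕ) (he : e.LoopsIn V) (hρ : ∀ p, ρ p ≤ M)
    (hx : e.eval σ ρ = x) (h : Reduces M c (Function.update ρ i x) σ c' ρ' σ') :
    Reduces M (.bind i e c) ρ σ c' ρ' σ' := by
  subst hx
  refine ⟨h.eval, ?_, fun h' => ?_⟩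
  · exact h.cost_ge.trans (by rw [Prog.cost]; omega)
  · have := h.cost_le h'
    have := e.cost_le σ ρ (V := V) (fun p _ => hρ p) he
    simp only [Prog.cost, Prog.bound]; omega

theorem Reduces.seq_step {M : ℕ} {c d : Prog} {ρ : ℕ → ℕ} {σ : Store}
    {c' : Prog} {ρ' : ℕ → ℕ} {σ' : Store} (V : List ℕ) (hc : c.LoopsIn V) (hρ : ∀ p, ρ p ≤ M)
    (h : Reduces M d ρ (c.eval ρ σ) c' ρ' σ') : Reduces M (.seq c d) ρ σ c' ρ' σ' := by
  refine ⟨h.eval, ?_, fun h' => ?_⟩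
  · exact h.cost_ge.trans (by rw [Prog.cost]; omega)
  · have := h.cost_le h'
    have := c.cost_le ρ σ (V := V) (fun p _ => hρ p) hc
    simp only [Prog.cost, Prog.bound]; omega

theorem Reduces.refl (M : ℕ) (c : Prog) (ρ : ℕ → ℕ) (σ : Store) : Reduces M c ρ σ c ρ σ :=
  ⟨rfl, le_rfl, id⟩

theorem update_le {ρ : ℕ → ℕ} {M x : ℕ} (h : ∀ p, ρ p ≤ M) (hx : x ≤ M) (i : ℕ) :
    ∀ p, Function.update ρ i x p ≤ M := by
  intro p
  rw [Function.update_apply]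
  split_ifs
  exacts [hx, h p]

theorem Prog.eval_power (ρ : ℕ → ℕ) (σ : Store) :
    (power.eval ρ σ).arr aTmp 0 = ρ vB ^ ρ vL := by
  have := iter_induction (N := ρ vL) (σ := σ.setArr aTmp 0 1) (f := fun j =>
    (Prog.store aTmp (.cst 0) (.sum vB vJ (.get aTmp (.cst 0)))).eval (Function.update ρ vI j))
    (fun j σ' => σ'.arr aTmp 0 = ρ vB ^ j) (by simp [Store.setArr_arr]) (by
    intro j hj σ' h
    simp [Prog.eval, Expr.eval, Store.setArr_arr, h, pow_succ, mul_comm])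
  exact this

/-- The number of vertices whose colours are guessed in a round. -/
def guesses (n q : ℕ) : ℕ := if q / 12 ≠ 0 then n / (q / 12 * (q / 12)) + 1 else n

/-- The number of values of a guess. -/
def guessBase (n q : ℕ) : ℕ := if q / 12 ≠ 0 then 3 * n + 1 else q

/-- The number of codes plus a quadratic term in n and q majorises every parameter, so `M` bounds
all loops. The listed properties of `ρ` are what correctness and running time need. -/
theorem exists_reduces (n q : ℕ) (hq : 3 ≤ q) (M : ℕ)
    (hM : guessBase n q ^ guesses n q + 20 * (n + q + 1) ^ 2 ≤ M) (c : Prog) (σ : Store) :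
    ∃ ρ σ', Reduces M (Prog.withParams c) (initVars n q) σ c ρ σ' ∧ (∀ p, ρ p ≤ M) ∧
      σ'.b = σ.b ∧ σ'.Edge = σ.Edge ∧ σ'.arr aCol = σ.arr aCol ∧ ρ vN = n ∧ Params ρ ∧
      ρ vN ≤ ρ vR * ρ vK ∧ ρ vR * ρ vS + ρ vD ≤ q ∧ 0 < ρ vR ∧
      ρ vP = guessBase n q ^ guesses n q := by
  have hM2 : 20 * (n + q + 1) ^ 2 ≤ M := by omega
  have hlin : 20 * (n + q + 1) ≤ M := by nlinarith
  set m := q / 12 with hm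
  set B := guessBase n q with hB
  set L := guesses n q with hL
  have hmq : 12 * m ≤ q := Nat.mul_div_le q 12
  have hmm : m * m ≤ M := by nlinarith
  have hLn : L ≤ n + 1 := by
    rw [hL, guesses]; split_ifs
    · exact Nat.add_le_add_right (Nat.div_le_self _ _) _
    · omega
  have hBM : B ≤ M := by rw [hB, guessBase]; split_ifs <;> omega
  have hK : (if m ≠ 0 then L * (6 * m) else n) ≤ M := by
    split_ifs
    · have := Nat.mul_le_mul hLn (show 6 * m ≤ q by omega)
      nlinarith
    · omega
  let V := [vN, vQ, vM, vMM, vB, vL, vT, vI]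
  have h0 : ∀ p, initVars n q p ≤ M := by
    intro p; unfold initVars; split_ifs <;> omega
  have h1 := update_le h0 (show 12 ≤ M by omega) vT
  have h2 := update_le h1 (show m ≤ M by omega) vM
  have h3 := update_le h2 hmm vMM
  have h4 := update_le h3 hBM vB
  have h5 := update_le h4 (show L ≤ M by omega) vL
  have h6 := update_le h5 (show (if m ≠ 0 then m else 1) ≤ M by split_ifs <;> omega) vR
  have h7 := update_le h6 (show (if m ≠ 0 then 6 else q) ≤ M by split_ifs <;> omega) vS
  have h8 := update_le h7 (show 6 ≤ M by omega) vI
  have h9 := update_le h8 (show (if m ≠ 0 then 6 * m else 0) ≤ M by split_ifs <;> omega) vD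
  have h10 := update_le h9 hK vK
  have h11 := update_le h10 (show B ^ L ≤ M by omega) vP
  -- One step for each parameter bound by `Prog.withParams`, and one for the computation of the
  -- number of codes.
  refine ⟨_, _, .let_step V ?_ h0 ?_ <| .let_step V ?_ h1 ?_ <| .let_step V ?_ h2 ?_ <|
    .let_step V ?_ h3 ?_ <| .let_step V ?_ h4 ?_ <| .let_step V ?_ h5 ?_ <|
    .let_step V ?_ h6 ?_ <| .let_step V ?_ h7 ?_ <| .let_step V ?_ h8 ?_ <|
    .let_step V ?_ h9 ?_ <| .seq_step [vB, vL] ?_ h10 <| .let_step V ?_ h10 ?_ (.refl _ _ _ _), h11,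
    Prog.eval_b _ _ _, Prog.eval_edge_of_silent (by simp [Prog.power, Prog.Silent]) _ _,
    Prog.eval_arr _ _ _ (by decide), ?_, ⟨?_, ?_⟩, ?_, ?_, ?_, ?_⟩
  case refine_1 | refine_3 | refine_5 | refine_7 | refine_9 | refine_11 | refine_13 | refine_15 |
      refine_17 | refine_19 | refine_21 | refine_22 =>
    simp [Expr.LoopsIn, Prog.LoopsIn, Expr.div, Expr.le, Prog.power, V]
  · rfl
  · have hd : (Expr.div vQ vT vX vY (.var vQ)).eval σ (Function.update (initVars n q) vT 12) =
        q / 12 :=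
      Expr.eval_div (t := q) _ _ (by decide) (by decide) (by simp)
        (by simp [Expr.eval, initVars]) (by simp [initVars])
    exact hd
  · simp [Expr.eval]
  · simp [Expr.eval, initVars, hB, guessBase, ← hm]
    split_ifs <;> omega
  · by_cases h : m = 0
    · simp [Expr.eval, initVars, hL, guesses, ← hm, h]
    · have hd : (Expr.div vN vMM vX vY (.var vN)).eval σ (Function.update (Function.update
          (Function.update (Function.update (initVars n q) vT 12) vM m) vMM (m * m)) vB B) =
          n / (m * m) := by
        rw [Expr.eval_div _ _ (t := n) (by decide) (by decide)
          (by simpa using h) (by simp [Expr.eval, initVars])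
          (by simp [initVars])]
        simp
      simp [Expr.eval, hL, guesses, ← hm, h, hd]
  · simp [Expr.eval]
  · simp [Expr.eval, initVars]
  · simp [Expr.eval]
  · simp [Expr.eval]
  · simp [Expr.eval, initVars]
    split_ifs <;> rfl
  · simp [Expr.eval, Prog.eval_power]
  · simp [initVars]
  · by_cases h : m = 0
    · left
      simp [h, initVars, hB, guessBase, hL, guesses, ← hm, hq]
    · right
      simp [h, initVars, hB, guessBase, ← hm]
  · simp
  · by_cases h : m = 0
    · simp [h, initVars]
    · simp [h, initVars, hL, guesses, ← hm]
      -- From n < m² * (n / m² + 1) = m² * L it follows that n ≤ m * (L * 6m).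
      have := Nat.lt_mul_div_succ n (show 0 < m * m by positivity)
      nlinarith
  · by_cases h : m = 0
    · simp [h]
    · simp [h]; omega
  · by_cases h : m = 0
    · simp [h]
    · simp [h]; omega
  · simp

/-! ### The algorithm -/

/-- The colouring algorithm as a program of the random access machine. -/
def algorithm : Cmd := (Prog.withParams Prog.main).machine

theorem edge_initStore {n : ℕ} (G : SimpleGraph (Fin n)) {u v : ℕ} (hu : u < n) (hv : v < n) :
    (initStore G).Edge n u v ↔ G.Adj ⟨u, hu⟩ ⟨v, hv⟩ := by
  classical
  have h1 : n * (u + 1) ≤ n * n := Nat.mul_le_mul_left _ hu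
  rw [mul_add] at h1
  have h2 : min (n * u + v) (initStore G).b = n * u + v := by
    refine min_eq_left ?_
    simp only [initStore]
    omega
  have h3 : (initStore G).low (n * u + v) =
      if ∃ u' v' : Fin n, n * u + v = n * u' + v' ∧ G.Adj u' v' then 1 else 0 := by
    simp only [initStore, input]
  rw [Store.Edge, h2, h3, boole_ne_zero]
  constructor
  · rintro ⟨u', v', h, hadj⟩
    have e1 : v = v' := by
      have := congrArg (· % n) h
      simpa [Nat.mod_eq_of_lt hv, Nat.mod_eq_of_lt v'.2] using this
    have e2 : u = u' := by
      rw [e1] at h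
      exact Nat.eq_of_mul_eq_mul_left (by omega) (Nat.add_right_cancel h)
    subst e1 e2
    exact hadj
  · intro h
    exact ⟨_, _, rfl, h⟩

theorem algorithm_findsColoring {n q : ℕ} (hq : 1 ≤ n → 3 ≤ q) (G : SimpleGraph (Fin n))
    (hG : G.Colorable 3) : FindsColoring algorithm G q := by
  obtain ⟨s, hs, rep⟩ := (Prog.withParams Prog.main).runs_machine G q
  refine ⟨_, s, hs, ?_⟩
  -- For n = 0 nothing is known about q, but the empty colouring needs no colours.
  rcases Nat.eq_zero_or_pos n with rfl | hn
  · exact ⟨.mk (fun v => v.elim0) fun {v} => v.elim0, fun v => v.elim0⟩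
  obtain ⟨c⟩ := hG
  obtain ⟨ρ, σ', red, -, hb, hedge, hcol, hN, par, hK, hcolors, -⟩ :=
    exists_reduces n q (hq hn) _ le_rfl Prog.main (initStore G)
  let f : ℕ → ℕ := fun u => if h : u < n then c ⟨u, h⟩ else 0
  have hb' : (initStore G).b = n * n + n := rfl
  obtain ⟨m1, m2⟩ := Prog.eval_main par σ' f (by rw [hb, hN, hb']) hK
    (by
      intro u hu
      rw [hN] at hu
      simp only [f, hu, dif_pos]
      exact (c _).2)
    (by
      intro u hu v hv huv
      rw [hN] at hu hv
      rw [hedge, hN, edge_initStore G hu hv] at huv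
      simp only [f, hu, hv, dif_pos]
      exact fun h => c.valid huv (Fin.ext h))
    (by
      intro u hu v hv huv
      rw [hN] at hu hv
      rw [hedge, hN] at huv ⊢
      rw [edge_initStore G hu hv] at huv
      rw [edge_initStore G hv hu]
      exact huv.symm)
    (by rw [hcol]; rfl)
  rw [← red.eval, hN] at m1 m2
  have mem : ∀ v < n, s.mem (n * n + v) =
      ((Prog.withParams Prog.main).eval (initVars n q) (initStore G)).low (n * n + v) :=
    fun v hv => rep.low _ (by rw [Prog.eval_b, hb']; omega)
  refine ⟨.mk (fun v => ⟨s.mem (n * n + v), ?_⟩) fun {u v} huv h => ?_, fun v => rfl⟩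
  · rw [mem v v.2]
    exact (m1 v v.2).trans_le hcolors
  · have h := Fin.mk.inj h
    rw [mem u u.2, mem v v.2] at h
    refine m2 u u.2 v v.2 ?_ h
    rw [hedge]
    exact (edge_initStore G u.2 v.2).2 huv

/-- The machine is deterministic and always halts, and there are finitely many graphs on n vertices.
The edgeless one shows that the set of times is nonempty. -/
theorem exists_isWorstCaseTime (n q : ℕ) : ∃ T, IsWorstCaseTime algorithm n q T := by
  let S := {t : ℕ | ∃ G : SimpleGraph (Fin n), G.Colorable 3 ∧
    ∃ s : State, Runs algorithm (input G q) t s}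
  have hfin : S.Finite := by
    refine (Set.finite_range fun G : SimpleGraph (Fin n) =>
      3 * n + 6 + (Prog.withParams Prog.main).cost (initVars n q) (initStore G)).subset ?_
    rintro t ⟨G, -, s, hs⟩
    obtain ⟨s', hs', -⟩ := (Prog.withParams Prog.main).runs_machine G q
    exact ⟨G, (hs'.deterministic hs).1⟩
  have hne : S.Nonempty := by
    obtain ⟨s', hs', -⟩ := (Prog.withParams Prog.main).runs_machine (⊥ : SimpleGraph (Fin n)) q
    exact ⟨_, ⊥, ⟨.mk (fun _ => 0) fun h => h.elim⟩, s', hs'⟩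
  exact ⟨sSup S, Nat.sSup_mem hne hfin.bddAbove, fun t ht => le_csSup hfin.bddAbove ht⟩

theorem Prog.loopsIn_main : main.LoopsIn [vN, vB, vL, vR, vS, vD, vP] := by
  simp [main, round, attempt, candidate, decode, extend, classify, bipartition, addEdge, merge,
    direct, accept, greedy, output, Prog.LoopsIn, Expr.LoopsIn, Expr.newProper, Expr.newMany,
    Expr.restSparse, Expr.all, Expr.and, Expr.or, Expr.eq, Expr.le, Expr.not, Expr.div, Expr.near,
    Expr.edge, Expr.cell]

/-- The first round alone runs through all `vP` codes. -/
theorem Prog.le_cost_main (ρ : ℕ → ℕ) (σ : Store) (hR : 0 < ρ vR) : ρ vP ≤ main.cost ρ σ := by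
  have loop : ∀ (p i : ℕ) (c : Prog) (ρ : ℕ → ℕ) (σ : Store), ρ p ≤ (Prog.loop p i c).cost ρ σ := by
    intro p i c ρ σ
    rw [Prog.cost]
    refine le_trans ?_ (Nat.le_add_right _ 5)
    refine le_trans ?_ (card_nsmul_le_sum _ _ 4 fun j _ => Nat.le_add_left 4 _)
    rw [card_range, smul_eq_mul]
    omega
  have hround : ∀ (r : ℕ) (σ : Store), ρ vP ≤ round.cost (Function.update ρ vRound r) σ := by
    intro r σ
    simp only [round, Prog.cost.eq_7, Prog.cost.eq_4]
    refine le_trans ?_ (Nat.le_add_left _ _)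
    refine le_trans ?_ (Nat.le_add_left _ _)
    refine le_trans ?_ (loop _ _ _ _ _)
    simp
  have hrounds : ρ vP ≤ (Prog.loop vR vRound round).cost ρ σ := by
    rw [Prog.cost]
    refine le_trans ?_ (Nat.le_add_right _ 5)
    refine le_trans ?_ (single_le_sum (fun _ _ => Nat.zero_le _) (mem_range.2 hR))
    exact (hround 0 _).trans (Nat.le_add_right _ _)
  rw [main, Prog.cost]
  exact hrounds.trans (Nat.le_add_right _ _)

/-- Both bounds hold for every graph, not only for the worst one. The cost is polynomial in `M`, and
since n + q + 1 ≤ 3n + 1 for q ≤ n, it is polynomial in the number of codes. -/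
theorem exists_time_bounds : ∃ C D : ℕ, 1 ≤ C ∧ ∀ n q : ℕ, 12 ≤ q → q ≤ n →
    ∀ (G : SimpleGraph (Fin n)) (t : ℕ) (s : State), Runs algorithm (input G q) t s →
      (3 * n + 1) ^ (n / (q / 12 * (q / 12)) + 1) ≤ t ∧
      t ≤ C * ((3 * n + 1) ^ (n / (q / 12 * (q / 12)) + 1)) ^ D := by
  obtain ⟨a, k, hak⟩ := (Prog.withParams Prog.main).polyBounded_bound
  -- M + 1 ≤ 22 P² turns a (M + 1)^k into a 22^k P^(2k); the 9 and the extra exponent 1 pay for the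
  -- prelude.
  refine ⟨9 + a * 22 ^ k, 2 * k + 1, by omega, fun n q hq hqn G t s hs => ?_⟩
  obtain ⟨s', hs', -⟩ := (Prog.withParams Prog.main).runs_machine G q
  have ht := (hs.deterministic hs').1
  obtain ⟨ρ, σ', red, hρ, -, -, -, -, -, -, -, hR, hP⟩ :=
    exists_reduces n q (by omega) _ le_rfl Prog.main (initStore G)
  have hm : q / 12 ≠ 0 := by omega
  have e1 : guessBase n q = 3 * n + 1 := if_pos hm
  have e2 : guesses n q = n / (q / 12 * (q / 12)) + 1 := if_pos hm
  rw [e1, e2] at hP hρ red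
  set P := (3 * n + 1) ^ (n / (q / 12 * (q / 12)) + 1) with hPdef
  have hlow := (Prog.le_cost_main ρ σ' hR).trans red.cost_ge
  have hup := (red.cost_le (Prog.cost_le _ _ _ (fun p _ => hρ p) Prog.loopsIn_main)).trans (hak _)
  rw [hP] at hlow
  refine ⟨by omega, ?_⟩
  have hnP : 3 * n + 1 ≤ P := Nat.le_self_pow (Nat.succ_ne_zero _) _
  have hP1 : 1 ≤ P := by omega
  have hbase : P + 20 * (n + q + 1) ^ 2 + 1 ≤ 22 * P ^ 2 := by
    have : (n + q + 1) ^ 2 ≤ P ^ 2 := Nat.pow_le_pow_left (by omega) 2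
    nlinarith
  have h1 : a * (P + 20 * (n + q + 1) ^ 2 + 1) ^ k ≤ a * 22 ^ k * P ^ (2 * k + 1) := by
    rw [mul_assoc]
    refine Nat.mul_le_mul_left _ ((Nat.pow_le_pow_left hbase k).trans ?_)
    rw [mul_pow, ← pow_mul]
    exact Nat.mul_le_mul_left _ (Nat.pow_le_pow_right hP1 (by omega))
  have h2 : P ≤ P ^ (2 * k + 1) := Nat.le_self_pow (by omega) _
  rw [ht, add_mul]
  omega

/-! ### Asymptotics -/

/-- Up to constant factors, log T is L log (3n + 1), where L is of order n / m² and m of order n^ε.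
Since ε < 1/2, n^(1 - 2ε) ≥ 1 absorbs the + 1 in L. -/
theorem theta_of_bounds {ε : ℝ} (h0 : 0 < ε) (h1 : ε < 1 / 2) {q T : ℕ → ℕ} {C D : ℕ} (hC : 1 ≤ C)
    (hq : (fun n : ℕ => (q n : ℝ)) =Θ[atTop] (fun n : ℕ => (n : ℝ) ^ ε))
    (hT : ∀ n, 12 ≤ q n → q n ≤ n →
      (3 * n + 1) ^ (n / (q n / 12 * (q n / 12)) + 1) ≤ T n ∧
      T n ≤ C * ((3 * n + 1) ^ (n / (q n / 12 * (q n / 12)) + 1)) ^ D) :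
    (fun n : ℕ => Real.logb 2 (T n)) =Θ[atTop]
      (fun n : ℕ => (n : ℝ) ^ (1 - 2 * ε) * Real.log n) := by
  obtain ⟨c₂, hc₂, b₂⟩ := hq.1.exists_pos
  obtain ⟨c₁, hc₁, b₁⟩ := hq.2.exists_pos
  have pow_atTop : ∀ δ : ℝ, 0 < δ → Tendsto (fun n : ℕ => (n : ℝ) ^ δ) atTop atTop := fun δ hδ =>
    (tendsto_rpow_atTop hδ).comp tendsto_natCast_atTop_atTop
  have hlog2 : 0 < Real.log 2 := Real.log_pos (by norm_num)
  -- The bounds 12m ≤ q ≤ 24m give 144 = 12² and 576 = 24². The + 1 comes from the rounding in L,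
  -- the factor 3 from log (3n + 1) ≤ 3 log n, and log C + D from passing to `C * P ^ D` with log P
  -- ≥ 1.
  have main : ∀ᶠ n : ℕ in atTop,
      144 / c₂ ^ 2 / Real.log 2 * ((n : ℝ) ^ (1 - 2 * ε) * Real.log n) ≤ Real.logb 2 (T n) ∧
      Real.logb 2 (T n) ≤ (Real.log C + D) * ((576 * c₁ ^ 2 + 1) * 3) / Real.log 2 *
        ((n : ℝ) ^ (1 - 2 * ε) * Real.log n) ∧
      0 ≤ (n : ℝ) ^ (1 - 2 * ε) * Real.log n := by
    -- The thresholds ensure 12 ≤ q and q ≤ n, and n ≥ 3 > e gives log n ≥ 1.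
    filter_upwards [b₂.bound, b₁.bound, (pow_atTop ε h0).eventually_ge_atTop (12 * c₁),
      (pow_atTop (1 - ε) (by linarith)).eventually_ge_atTop c₂, eventually_ge_atTop 3]
      with n u₂ u₁ v₁ v₂ hn
    have hn' : (3 : ℝ) ≤ n := by exact_mod_cast hn
    have hn0 : (0 : ℝ) < n := by linarith
    have hpos : 0 < (n : ℝ) ^ ε := Real.rpow_pos_of_pos hn0 _
    simp only [Real.norm_natCast, Real.norm_of_nonneg hpos.le] at u₁ u₂
    have hq12 : (12 : ℝ) ≤ q n := by
      by_contra h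
      push Not at h
      nlinarith
    have hqn : (q n : ℝ) ≤ n := by
      have : (n : ℝ) ^ ε * (n : ℝ) ^ (1 - ε) = n := by
        rw [← Real.rpow_add hn0]; simp
      nlinarith
    have hq0 : (0 : ℝ) < q n := by linarith
    obtain ⟨t₁, t₂⟩ := hT n (by exact_mod_cast hq12) (by exact_mod_cast hqn)
    set m := q n / 12 with hm
    set L := n / (m * m) + 1 with hL
    have hm1 : 1 ≤ m := by
      have : 12 ≤ q n := by exact_mod_cast hq12
      omega
    have hm0 : (0 : ℝ) < m := by exact_mod_cast hm1
    have hmu : 12 * (m : ℝ) ≤ q n := by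
      have : 12 * m ≤ q n := Nat.mul_div_le _ _
      exact_mod_cast this
    have hml : (q n : ℝ) ≤ 24 * m := by
      have : q n ≤ 24 * m := by omega
      exact_mod_cast this
    have hLl : (n : ℝ) / (m * m) ≤ L := by
      rw [hL]
      push_cast
      have := (Nat.lt_floor_add_one ((n : ℝ) / ((m * m : ℕ) : ℝ))).le
      rw [Nat.floor_div_eq_div] at this
      push_cast at this
      exact this
    have hLu : (L : ℝ) ≤ n / (m * m) + 1 := by
      rw [hL]
      push_cast
      have := Nat.cast_div_le (α := ℝ) (m := n) (n := m * m)
      push_cast at this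
      linarith
    set x := (n : ℝ) ^ (1 - 2 * ε) with hx
    have hx1 : 1 ≤ x := Real.one_le_rpow (by linarith) (by linarith)
    have hxe : x * ((n : ℝ) ^ ε) ^ 2 = n := by
      rw [hx, ← Real.rpow_natCast, ← Real.rpow_mul hn0.le, ← Real.rpow_add hn0]
      norm_num
      rw [show 1 - 2 * ε + ε * 2 = 1 by ring, Real.rpow_one]
    have hx0 : 0 < x := by linarith
    have hLx : 144 / c₂ ^ 2 * x ≤ L := by
      refine le_trans ?_ hLl
      rw [div_mul_eq_mul_div, div_le_div_iff₀ (by positivity) (by positivity)]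
      have : (12 * (m : ℝ)) ^ 2 ≤ (c₂ * (n : ℝ) ^ ε) ^ 2 :=
        pow_le_pow_left₀ (by positivity) (hmu.trans u₂) 2
      calc 144 * x * (m * m) = x * (12 * (m : ℝ)) ^ 2 := by ring
        _ ≤ x * (c₂ * (n : ℝ) ^ ε) ^ 2 := by gcongr
        _ = x * ((n : ℝ) ^ ε) ^ 2 * c₂ ^ 2 := by ring
        _ = n * c₂ ^ 2 := by rw [hxe]
    have hxL : (L : ℝ) ≤ (576 * c₁ ^ 2 + 1) * x := by
      refine hLu.trans ?_
      rw [add_mul, one_mul]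
      refine add_le_add ?_ hx1
      rw [div_le_iff₀ (by positivity)]
      have : ((n : ℝ) ^ ε) ^ 2 ≤ (c₁ * (24 * m)) ^ 2 :=
        pow_le_pow_left₀ (by positivity) (u₁.trans (by gcongr)) 2
      calc (n : ℝ) = x * ((n : ℝ) ^ ε) ^ 2 := hxe.symm
        _ ≤ x * (c₁ * (24 * m)) ^ 2 := by gcongr
        _ = 576 * c₁ ^ 2 * x * (m * m) := by ring
    have hlogn : 1 ≤ Real.log n := by
      rw [Real.le_log_iff_exp_le hn0]
      have := Real.exp_one_lt_d9
      linarith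
    have hlogl : Real.log n ≤ Real.log (3 * n + 1) := Real.log_le_log hn0 (by linarith)
    have hlogu : Real.log (3 * n + 1) ≤ 3 * Real.log n := by
      have : (3 : ℝ) * Real.log n = Real.log (n ^ 3) := by rw [Real.log_pow]; norm_num
      rw [this]
      refine Real.log_le_log (by linarith) ?_
      nlinarith [mul_le_mul hn' hn' (by norm_num) hn0.le]
    set P := (3 * n + 1) ^ L with hP
    have hP0 : (0 : ℝ) < (P : ℝ) := by rw [hP]; positivity
    have hlogP : Real.log P = L * Real.log (3 * n + 1) := by
      rw [hP]; push_cast; rw [Real.log_pow]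
    have hL1 : (1 : ℝ) ≤ L := by exact_mod_cast (show 1 ≤ L from Nat.le_add_left 1 _)
    have hlog0 : 0 ≤ Real.log (3 * n + 1) := by linarith
    have hlogP1 : 1 ≤ Real.log P := by
      rw [hlogP]; nlinarith
    have hT1 : (P : ℝ) ≤ T n := by exact_mod_cast t₁
    have hT2 : (T n : ℝ) ≤ C * (P : ℝ) ^ D := by exact_mod_cast t₂
    have hT0 : (0 : ℝ) < T n := hP0.trans_le hT1
    have hC' : (1 : ℝ) ≤ C := by exact_mod_cast hC
    have hlogC : 0 ≤ Real.log C := Real.log_nonneg hC'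
    have hlogT1 : Real.log P ≤ Real.log (T n) := Real.log_le_log hP0 hT1
    have hlogT2 : Real.log (T n) ≤ (Real.log C + D) * Real.log P := by
      refine (Real.log_le_log hT0 hT2).trans ?_
      rw [Real.log_mul (by positivity) (by positivity), Real.log_pow, add_mul]
      nlinarith
    refine ⟨?_, ?_, by positivity⟩
    · rw [Real.logb, div_mul_eq_mul_div]
      refine div_le_div_of_nonneg_right (le_trans ?_ hlogT1) hlog2.le
      rw [hlogP, ← mul_assoc]
      gcongr
    · rw [Real.logb, div_mul_eq_mul_div]
      refine div_le_div_of_nonneg_right (hlogT2.trans ?_) hlog2.le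
      rw [hlogP, mul_assoc (Real.log C + D)]
      refine mul_le_mul_of_nonneg_left ?_ (by positivity)
      calc L * Real.log (3 * n + 1) ≤ ((576 * c₁ ^ 2 + 1) * x) * (3 * Real.log n) := by gcongr
        _ = (576 * c₁ ^ 2 + 1) * 3 * (x * Real.log n) := by ring
  have hc : 0 < 144 / c₂ ^ 2 / Real.log 2 := by positivity
  constructor
  · refine .of_bound ((Real.log C + D) * ((576 * c₁ ^ 2 + 1) * 3) / Real.log 2) (main.mono fun n ⟨a, b, c⟩ => ?_)
    have : 0 ≤ Real.logb 2 (T n) := (mul_nonneg hc.le c).trans a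
    rw [Real.norm_of_nonneg this, Real.norm_of_nonneg c]
    exact b
  · refine .of_bound (144 / c₂ ^ 2 / Real.log 2)⁻¹ (main.mono fun n ⟨a, b, c⟩ => ?_)
    have : 0 ≤ Real.logb 2 (T n) := (mul_nonneg hc.le c).trans a
    rw [Real.norm_of_nonneg this, Real.norm_of_nonneg c, inv_mul_eq_div, le_div_iff₀' hc]
    exact a

end LoopLang

theorem theorem6p4 :
    ∃ P : RAM.Cmd, ∀ (ε : ℝ) (q : ℕ → ℕ), 0 < ε → ε < 1 / 2 →
      (∀ n : ℕ, 1 ≤ n → 3 ≤ q n) →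
      (fun n : ℕ => (q n : ℝ)) =Θ[atTop] (fun n : ℕ => (n : ℝ) ^ ε) →
      (∀ (n : ℕ) (G : SimpleGraph (Fin n)), G.Colorable 3 → RAM.FindsColoring P G (q n)) ∧
      ∃ T : ℕ → ℕ, (∀ n : ℕ, RAM.IsWorstCaseTime P n (q n) (T n)) ∧
        (fun n : ℕ => Real.logb 2 (T n)) =Θ[atTop]
          (fun n : ℕ => (n : ℝ) ^ (1 - 2 * ε) * Real.log n) := by
  refine ⟨LoopLang.algorithm, fun ε q h0 h1 hq3 hq =>
    ⟨fun n G hG => LoopLang.algorithm_findsColoring (hq3 n) G hG, ?_⟩⟩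
  choose T hT using fun n => LoopLang.exists_isWorstCaseTime n (q n)
  obtain ⟨C, D, hC, bounds⟩ := LoopLang.exists_time_bounds
  refine ⟨T, hT, LoopLang.theta_of_bounds (D := D) h0 h1 hC hq fun n h12 hqn => ?_⟩
  obtain ⟨G, -, s, hs⟩ := (hT n).1
  exact bounds n (q n) h12 hqn G (T n) s hs
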